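/- **Setting.** Consider a finite set $L$ of links with capacities $c_l>0$ and a finite set $S$ of sources; each source $s$ has a finite set of routes $r\in s$, every route is a nonempty set of links, and $R$ is the set of all routes. Let $H\in\{0,1\}^{L\times R}$ be the routing matrix, $H_{lr}=1$ iff $l\in r$. For rates $\mathbf x\in\mathbb R_+^{R}$, $\mathbf x=(\mathbf x_s)_{s\in S}$, and prices $\mathbf p\in\mathbb R_+^{L}$ put $y_l=\sum_{r\in R}H_{lr}x_r$ and $q_r=\sum_{l\in L}H_{lr}p_l$. The fluid dynamics are $$\dot x_r=k_r(\mathbf x_s)\,\bigl(\phi_r(\mathbf x_s)-q_r\bigr)^+_{x_r}\quad(r\in s,\ s\in S),\qquad \dot p_l=\gamma_l\,(y_l-c_l)^+_{p_l}\quad(l\in L),$$ where $(a)^+_x=a$ if $x>0$ and $(a)^+_x=\max\{0,a\}$ if $x\le 0$. Here $\gamma_l>0$; the gains $k_r$ are positive and continuous at all $\mathbf x_s>0$; and $\phi_r:\mathbb R_+^{s}\to\mathbb R\cup\{\infty\}$ never vanishes. Write $\Phi_s=(\phi_r)_{r\in s}$. A point $(\mathbf x,\mathbf p)$ is an *equilibrium*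 if for all $r\in s$, $s\in S$, $l\in L$ $$\text{(a)}\ \ x_r\ge0,\ \phi_r(\mathbf x_s)\le q_r,\ \phi_r(\mathbf x_s)=q_r\text{ if }x_r>0;\qquad \text{(b)}\ \ p_l\ge0,\ y_l\le c_l,\ y_l=c_l\text{ if }p_l>0 .$$ A *trajectory* on $[0,T)$, $0<T\le\infty$, is a locally absolutely continuous $(\mathbf x,\mathbf p):[0,T)\to\mathbb R_+^{R}\times\mathbb R_+^{L}$ with $\mathbf x(t)>0$ that satisfies the dynamics, both for almost all $t$ (initial rates may be $0$). **Conditions.** - C1: for each $s$ there is a map $\mathbf p\mapsto\mathbf x_s(\mathbf p)$, defined for all finite $\mathbf p\ge0$ with $q_r>0$ for all $r$, such that $\mathbf x_s(\mathbf p)$ satisfies (a), and such that $y_l^s(\mathbf p)=\sum_{r\in s}H_{lr}x_r(\mathbf p)$ satisfies $\partial y_l^s/\partial p_l\le0$ (one-sided if $p_l=0$) and $\lim_{p_l\to\infty}y_l^s(\mathbf p)=0$ for all $l\in L$. - C2: for each $s$, $\Phi_s$ is continuous on $\mathbb R_+^{s}$ as a map with values in $(\mathbb R\cup\{\infty\})^s$,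 and at all $\mathbf x_s>0$ it is continuously differentiable and the symmetric part of its Jacobian is negative definite. - C3: for each route $r\in s$ and each $\mathbf x_s\ge0$, $\phi_r(\mathbf x_s)=\infty$ if and only if $x_r=0$; and $H$ has full row rank. **Theorem.** Suppose that C1, C2 and C3 hold and that each gain depends on the rate of its own route only, $k_r(\mathbf x_s)\equiv k_r(x_r)$ for all $r\in R$. Then the dynamics have exactly one equilibrium $(\mathbf x^*,\mathbf p^*)$, and it is globally asymptotically stable: (i) for every $\varepsilon>0$ there is $\delta>0$ such that every trajectory (on any $[0,T)$) that starts within distance $\delta$ of $(\mathbf x^*,\mathbf p^*)$ stays within distance $\varepsilon$ of it; and (ii) every trajectory on $[0,\infty)$, from any initial point $\mathbf x(0)\in\mathbb R_+^{R}$, $\mathbf p(0)\in\mathbb R_+^{L}$, converges to $(\mathbf x^*,\mathbf p^*)$ as $t\to\infty$. If moreover $\int_1^\infty \frac{z}{k_r(z)}\,dz=\infty$ for every $r\in R$ (as for $k_r(x_r)=\tfrac12x_r^2$), then every trajectory on any $[0,T)$, $T\le\infty$, is bounded; in particular none blows up in finite time. -/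

import Mathlib

open Filter Topology MeasureTheory

noncomputable section

namespace MPTCP

/-- A network with finite link set `L`, finite source set `S`, and a finite set `ρ s` of routes
for each source `s`, together with a multipath congestion control algorithm `(K, Φ)` and the link
algorithm `γ`. The rate vector of source `s` is `x s : ρ s → ℝ`, the full rate vector is
`x : ∀ s, ρ s → ℝ`, the price vector is `p : L → ℝ`. The proposition fields are the standing
assumptions of the model. -/
structure Network (L S : Type*) (ρ : S → Type*) where
  /-- The set of links that a route consists of. -/
  links : ∀ s, ρ s → Set L
  links_nonempty : ∀ s r, (links s r).Nonempty
  /-- Link capacities. -/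
  c : L → ℝ
  c_pos : ∀ l, 0 < c l
  /-- Link gains. -/
  γ : L → ℝ
  γ_pos : ∀ l, 0 < γ l
  /-- Source gains `k_r(x_s)`. -/
  k : ∀ s, ρ s → (ρ s → ℝ) → ℝ
  /-- Gains are positive and continuous at positive rates. Nothing is asked of them where some
  rate vanishes, so that gains such as `x_r ^ 2 / 2` are included. -/
  k_pos : ∀ s r (x : ρ s → ℝ), (∀ i, 0 < x i) → 0 < k s r x
  k_continuousOn : ∀ s r, ContinuousOn (k s r) {x | ∀ i, 0 < x i}
  /-- The functions `φ_r(x_s)`, with values in `ℝ ∪ {∞}` at all (finite) `x_s ≥ 0`, and never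
  zero there. -/
  φ : ∀ s, ρ s → (ρ s → ℝ) → EReal
  φ_ne_bot : ∀ s r (x : ρ s → ℝ), (∀ i, 0 ≤ x i) → φ s r x ≠ ⊥
  φ_ne_zero : ∀ s r (x : ρ s → ℝ), (∀ i, 0 ≤ x i) → φ s r x ≠ 0

variable {L S : Type*} {ρ : S → Type*}

open Classical in
/-- The routing matrix `H ∈ {0, 1}^{L × R}`, where `R` is the set of all routes. -/
def Network.H (N : Network L S ρ) : Matrix L (Σ s, ρ s) ℝ :=
  Matrix.of fun l r => if l ∈ N.links r.1 r.2 then 1 else 0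

/-- The aggregate price `q_r = ∑_l H_{lr} p_l` of route `r` of source `s`. -/
def Network.q [Fintype L] (N : Network L S ρ) (p : L → ℝ) (s : S) (r : ρ s) : ℝ :=
  ∑ l, N.H l ⟨s, r⟩ * p l

/-- The traffic `∑_{r ∈ s} H_{lr} x_r` from source `s` on link `l`. -/
def Network.ySource [∀ s, Fintype (ρ s)] (N : Network L S ρ) (s : S) (xs : ρ s → ℝ) (l : L) : ℝ :=
  ∑ r, N.H l ⟨s, r⟩ * xs r

/-- The aggregate traffic `y_l = ∑_{r ∈ R} H_{lr} x_r` on link `l`. -/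
def Network.y [Fintype S] [∀ s, Fintype (ρ s)] (N : Network L S ρ) (x : ∀ s, ρ s → ℝ) (l : L) : ℝ :=
  ∑ r : Σ s, ρ s, N.H l r * x r.1 r.2

/-- `x_r ≥ 0`, `φ_r(x_s) ≤ q_r`, and `φ_r(x_s) = q_r` if `x_r > 0`, for all routes `r` of the
source `s`. -/
def Network.SourceEquilibrium [Fintype L] (N : Network L S ρ) (s : S) (xs : ρ s → ℝ)
    (p : L → ℝ) : Prop :=
  ∀ r, 0 ≤ xs r ∧ N.φ s r xs ≤ (N.q p s r : EReal) ∧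
    (0 < xs r → N.φ s r xs = (N.q p s r : EReal))

/-- `p_l ≥ 0`, `y_l ≤ c_l`, and `y_l = c_l` if `p_l > 0`, for all links `l`. -/
def Network.LinkEquilibrium [Fintype S] [∀ s, Fintype (ρ s)] (N : Network L S ρ)
    (x : ∀ s, ρ s → ℝ) (p : L → ℝ) : Prop :=
  ∀ l, 0 ≤ p l ∧ N.y x l ≤ N.c l ∧ (0 < p l → N.y x l = N.c l)

/-- Equilibria `z = (x, p)` of the projected fluid dynamics. -/
def Network.IsEquilibrium [Fintype L] [Fintype S] [∀ s, Fintype (ρ s)] (N : Network L S ρ)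
    (z : (∀ s, ρ s → ℝ) × (L → ℝ)) : Prop :=
  (∀ s, N.SourceEquilibrium s (z.1 s) z.2) ∧ N.LinkEquilibrium z.1 z.2

/-! ### The conditions on the algorithm -/

open Classical in
/-- Condition C1. For each source `s` there is a solution map `p ↦ x_s(p)` of the source
equilibrium conditions, for all finite `p ≥ 0` with all `q_r > 0`; along it the traffic of `s` on
each link `l` has partial derivative `≤ 0` in `p_l` (one-sided when `p_l = 0`) and tends to `0` as
`p_l → ∞`. -/
def Network.C1 [Fintype L] [∀ s, Fintype (ρ s)] (N : Network L S ρ) : Prop :=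
  ∀ s, ∃ X : (L → ℝ) → ρ s → ℝ,
    ∀ p : L → ℝ, (∀ l, 0 ≤ p l) → (∀ s' r, 0 < N.q p s' r) →
      N.SourceEquilibrium s (X p) p ∧
      ∀ l,
        (∃ d ≤ 0, HasDerivWithinAt (fun t => N.ySource s (X (Function.update p l t)) l) d
          (Set.Ici 0) (p l)) ∧
        Tendsto (fun t => N.ySource s (X (Function.update p l t)) l) atTop (𝓝 0)

/-- The real-valued map `x_s ↦ Φ_s(x_s)`; meaningful where `Φ_s` is finite. -/
def Network.Φ (N : Network L S ρ) (s : S) (xs : ρ s → ℝ) : ρ s → ℝ :=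
  fun r => (N.φ s r xs).toReal

open Classical in
/-- The Jacobian matrix of `F` at `x`. -/
def jacobian {ι : Type*} [Fintype ι] (F : (ι → ℝ) → ι → ℝ) (x : ι → ℝ) : Matrix ι ι ℝ :=
  LinearMap.toMatrix' (fderiv ℝ F x).toLinearMap

/-- The symmetric part `[P]⁺ = (P + Pᵀ) / 2`. -/
def symPart {ι : Type*} (P : Matrix ι ι ℝ) : Matrix ι ι ℝ := (2⁻¹ : ℝ) • (P + P.transpose)

/-- Condition C2. `Φ_s` is continuous, as a map into `ℝ ∪ {∞}`, at all `x_s ≥ 0`, and it is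
continuously differentiable, with a Jacobian whose symmetric part is negative definite, at all
`x_s > 0` (the points where, by C3, all its components are finite). -/
def Network.C2 [∀ s, Fintype (ρ s)] (N : Network L S ρ) : Prop :=
  ∀ s,
    (∀ r, ContinuousOn (N.φ s r) {x | ∀ i, 0 ≤ x i}) ∧
    ContDiffOn ℝ 1 (N.Φ s) {x | ∀ i, 0 < x i} ∧
    ∀ x : ρ s → ℝ, (∀ i, 0 < x i) → (-(symPart (jacobian (N.Φ s) x))).PosDef

/-- Condition C3. `φ_r(x_s) = ∞` if and only if `x_r = 0`, and `H` has full row rank. -/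
def Network.C3 [Fintype L] [Fintype S] [∀ s, Fintype (ρ s)] (N : Network L S ρ) : Prop :=
  (∀ s r (x : ρ s → ℝ), (∀ i, 0 ≤ x i) → (N.φ s r x = ⊤ ↔ x r = 0)) ∧
    N.H.rank = Fintype.card L

/-- `k_r(x_s) ≡ k_r(x_r)`: each gain is a function of the rate of its own route only. -/
def Network.GainOfOwnRate (N : Network L S ρ) : Prop :=
  ∀ s r (x x' : ρ s → ℝ), (∀ i, 0 < x i) → (∀ i, 0 < x' i) → x r = x' r →
    N.k s r x = N.k s r x'

/-! ### The dynamics -/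

/-- `(a)_x^+`, equal to `a` for `x > 0` and to `max {0, a}` for `x ≤ 0`. -/
def proj (a x : ℝ) : ℝ := if 0 < x then a else max 0 a

/-- `z = (x, p)` is a (Carathéodory) trajectory on `[0, T)`, `0 < T ≤ ∞`, of
`x_r' = k_r(x_s) (φ_r(x_s) - q_r)_{x_r}^+`, `p_l' = γ_l (y_l - c_l)_{p_l}^+`:
it lies in the nonnegative orthant, is locally absolutely continuous, and satisfies the equations
at almost all times. The initial rates may vanish; but where `x_r = 0` the right-hand side
`k_r (∞ - q_r)^+` is infinite, so no real derivative satisfies the equation there, and the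
rates are positive at almost all times. -/
structure Network.IsTrajectory [Fintype L] [Fintype S] [∀ s, Fintype (ρ s)] (N : Network L S ρ)
    (T : EReal) (z : ℝ → (∀ s, ρ s → ℝ) × (L → ℝ)) : Prop where
  rate_nonneg : ∀ t : ℝ, 0 ≤ t → (t : EReal) < T → ∀ s r, 0 ≤ (z t).1 s r
  price_nonneg : ∀ t : ℝ, 0 ≤ t → (t : EReal) < T → ∀ l, 0 ≤ (z t).2 l
  rate_ac : ∀ b : ℝ, 0 ≤ b → (b : EReal) < T → ∀ s r,
    AbsolutelyContinuousOnInterval (fun t => (z t).1 s r) 0 b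
  price_ac : ∀ b : ℝ, 0 ≤ b → (b : EReal) < T → ∀ l,
    AbsolutelyContinuousOnInterval (fun t => (z t).2 l) 0 b
  rate_eq : ∀ᵐ t : ℝ, 0 < t → (t : EReal) < T → ∀ s r, 0 < (z t).1 s r ∧
    HasDerivAt (fun τ => (z τ).1 s r)
      (N.k s r ((z t).1 s) * proj (N.Φ s ((z t).1 s) r - N.q (z t).2 s r) ((z t).1 s r)) t
  price_eq : ∀ᵐ t : ℝ, 0 < t → (t : EReal) < T → ∀ l,
    HasDerivAt (fun τ => (z τ).2 l) (N.γ l * proj (N.y (z t).1 l - N.c l) ((z t).2 l)) t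

/-- Lyapunov stability of the point `e`, for trajectories of any finite or infinite duration. -/
def Network.LyapunovStable [Fintype L] [Fintype S] [∀ s, Fintype (ρ s)] (N : Network L S ρ)
    (e : (∀ s, ρ s → ℝ) × (L → ℝ)) : Prop :=
  ∀ ε > 0, ∃ δ > 0, ∀ (T : EReal) (z : ℝ → (∀ s, ρ s → ℝ) × (L → ℝ)), N.IsTrajectory T z →
    dist (z 0) e < δ → ∀ t : ℝ, 0 ≤ t → (t : EReal) < T → dist (z t) e < ε

/-- Every trajectory on `[0, ∞)`, whatever its initial point in the nonnegative orthant,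
converges to `e`. -/
def Network.GloballyAttractive [Fintype L] [Fintype S] [∀ s, Fintype (ρ s)] (N : Network L S ρ)
    (e : (∀ s, ρ s → ℝ) × (L → ℝ)) : Prop :=
  ∀ z : ℝ → (∀ s, ρ s → ℝ) × (L → ℝ), N.IsTrajectory ⊤ z → Tendsto z atTop (𝓝 e)

/-- Global asymptotic stability. -/
def Network.GloballyAsymptoticallyStable [Fintype L] [Fintype S] [∀ s, Fintype (ρ s)]
    (N : Network L S ρ) (e : (∀ s, ρ s → ℝ) × (L → ℝ)) : Prop :=
  N.LyapunovStable e ∧ N.GloballyAttractive e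

/-- `∫_1^∞ z / k_r(z) dz = ∞` for every route `r`, where `k_r` depends on `x_r` only. -/
def Network.GainIntegralDiverges (N : Network L S ρ) : Prop :=
  ∀ s r, Tendsto (fun b : ℝ => ∫ u in (1 : ℝ)..b, u / N.k s r (fun _ => u)) atTop atTop

/-- No trajectory, of finite or infinite duration, is unbounded. -/
def Network.TrajectoriesBounded [Fintype L] [Fintype S] [∀ s, Fintype (ρ s)]
    (N : Network L S ρ) : Prop :=
  ∀ (T : EReal) (z : ℝ → (∀ s, ρ s → ℝ) × (L → ℝ)), N.IsTrajectory T z →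
    ∃ B : ℝ, ∀ t : ℝ, 0 ≤ t → (t : EReal) < T → ‖z t‖ ≤ B

end MPTCP

end

/-!
The equilibrium conditions form a monotone variational inequality, and the dynamics are its
primal-dual flow. Everything rests on one fact, `sum_mul_sub_neg_of_jacobian`: since the symmetric
part of the Jacobian of `Φ_s` is negative definite, `(x - x') · (Φ(x) - Φ(x')) < 0` for distinct
positive rates. Together with the duality `∑_r x_r q_r = ∑_l y_l p_l` (`sum_mul_q`) it shows that
the operator `(x, p) ↦ (q(p) - Φ(x), c - y(x))` is monotone, and that two equilibria have the same
rates; as `H` has full row rank, prices are determined by route prices, hence by rates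
(`IsEquilibrium.eq`).

*Existence.* For a monotone operator, Minty's form of the variational inequality has a solution on
every compact convex set (`exists_minty_solution`): by compactness finitely many test points
suffice, and for those it is a skew matrix game, settled by the minimax theorem. On a box of rates
and prices, testing against small rates and large prices shows that the upper faces of a large box
are not active, and `φ_r = ∞` at `x_r = 0` keeps the rates off the lower faces. Moving the test
point towards the solution then gives `Φ(x) = q` and the complementarity conditions on the links.

*Stability.* The energy `V = ∑_r ∫_{x*_r}^{x_r} (u - x*_r) / k_r(u) du + ∑_l (p_l - p*_l)² / (2 γ_l)`
makes sense because each gain depends on its own rate only. Along a trajectory it is absolutely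
continuous where the rates are positive, and they are positive at all times `t > 0` since `φ_r`
pushes away from `0` (`IsTrajectory.rate_pos`); its derivative is at most `-W(x)` with the
dissipation `W(x) = (x - x*) · (Φ(x*) - Φ(x)) ≥ 0` (`IsEquilibrium.energy_sub_le`). Sublevel sets of
`V` shrink to the equilibrium, which is Lyapunov stability, and they are bounded when
`∫ z / k_r(z) dz` diverges, which is boundedness of trajectories.

*Attractivity.* In general only the prices are bounded by `V`, so compactness of trajectories is not
available and LaSalle's principle is avoided. By monotonicity along rays `W` is bounded below
outside each ball around `x*` (`C2.exists_le_dissipation`), so a trajectory returns to the ball of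
radius `η / 2`; leaving the ball of radius `η` afterwards takes a minimal time, as speeds near `x*`
are bounded, and so costs a fixed amount of energy, which eventually is no longer there. Hence
`x → x*`. Then route prices converge by a Barbalat argument (`tendsto_of_tendsto_of_hasDerivAt`): a
persistent gap `φ_r - q_r` would move `x_r`. Full row rank turns this into `p → p*`.
-/

noncomputable section

namespace MPTCP

/-! ### Minty solutions of monotone variational inequalities -/

/-- A matrix game whose symmetric part is nonnegative has nonnegative value: by the minimax theorem
it has a saddle point `(a, b)`, and the payoff at `(b, b)` is decided by the symmetric part. -/
theorem exists_mem_stdSimplex_forall_sum_nonneg {ι : Type*} [Fintype ι] [Nonempty ι]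
    (A : ι → ι → ℝ) (hA : ∀ i j, 0 ≤ A i j + A j i) :
    ∃ w ∈ stdSimplex ℝ ι, ∀ i, 0 ≤ ∑ j, w j * A i j := by
  classical
  let f : (ι → ℝ) → (ι → ℝ) → ℝ := fun x y => ∑ i, ∑ j, -(y i * (x j * A i j))
  have hc1 : ∀ y, Continuous fun x => f x y := fun y => by unfold f; fun_prop
  have hc2 : ∀ x, Continuous fun y => f x y := fun y => by unfold f; fun_prop
  have hl1 : ∀ y, IsLinearMap ℝ fun x => f x y := fun y =>
    { map_add := fun a b => by
        simp only [f, ← Finset.sum_add_distrib, Pi.add_apply]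
        exact Finset.sum_congr rfl fun i _ => Finset.sum_congr rfl fun j _ => by ring
      map_smul := fun c b => by
        simp only [f, Finset.mul_sum, Pi.smul_apply, smul_eq_mul]
        exact Finset.sum_congr rfl fun i _ => Finset.sum_congr rfl fun j _ => by ring }
  have hl2 : ∀ x, IsLinearMap ℝ fun y => f x y := fun y =>
    { map_add := fun a b => by
        simp only [f, ← Finset.sum_add_distrib, Pi.add_apply]
        exact Finset.sum_congr rfl fun i _ => Finset.sum_congr rfl fun j _ => by ring
      map_smul := fun c b => by
        simp only [f, Finset.mul_sum, Pi.smul_apply, smul_eq_mul]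
        exact Finset.sum_congr rfl fun i _ => Finset.sum_congr rfl fun j _ => by ring }
  have hne : (stdSimplex ℝ ι).Nonempty :=
    ⟨_, single_mem_stdSimplex ℝ (Classical.arbitrary ι)⟩
  obtain ⟨a, ha, b, hb, hab⟩ := Sion.exists_isSaddlePointOn (f := f) hne
    (convex_stdSimplex ℝ ι) (isCompact_stdSimplex ℝ ι)
    (fun y _ => (hc1 y).continuousOn.lowerSemicontinuousOn)
    (fun y _ => ((hl1 y).mk' _).convexOn (convex_stdSimplex ℝ ι) |>.quasiconvexOn)
    (convex_stdSimplex ℝ ι) hne (isCompact_stdSimplex ℝ ι)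
    (fun x _ => (hc2 x).continuousOn.upperSemicontinuousOn)
    (fun x _ => ((hl2 x).mk' _).concaveOn (convex_stdSimplex ℝ ι) |>.quasiconcaveOn)
  refine ⟨a, ha, fun i => ?_⟩
  have h1 := hab b hb _ (single_mem_stdSimplex ℝ i)
  have h2 : f a (Pi.single i 1) = -∑ j, a j * A i j := by
    simp only [f, Finset.sum_neg_distrib]
    rw [Finset.sum_eq_single i]
    · simp
    · intro k _ hk; simp [Pi.single_eq_of_ne hk]
    · simp
  -- Symmetrizing the double sum shows that the form is nonpositive on the diagonal.
  have h3 : f b b ≤ 0 := by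
    have e1 : f b b = ∑ i, ∑ j, -(b i * (b j * A j i)) := by
      simp only [f]; rw [Finset.sum_comm]
      exact Finset.sum_congr rfl fun i _ => Finset.sum_congr rfl fun j _ => by ring
    have e2 : f b b + f b b ≤ 0 := by
      nth_rewrite 2 [e1]
      simp only [f, ← Finset.sum_add_distrib]
      refine Finset.sum_nonpos fun i _ => Finset.sum_nonpos fun j _ => ?_
      have := mul_nonneg (mul_nonneg (hb.1 i) (hb.1 j)) (hA i j)
      nlinarith
    linarith
  linarith

/-- Minty's variational inequality for a monotone operator `G` on `D` has a solution in every
nonempty compact convex set containing `D`. No continuity of `G` is needed. -/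
theorem exists_minty_solution {E : Type*} [AddCommGroup E] [Module ℝ E] [TopologicalSpace E]
    [T2Space E] [ContinuousSub E] {K D : Set E} (hK : IsCompact K) (hKc : Convex ℝ K) (hKn : K.Nonempty)
    (hDK : D ⊆ K) (G : E → E →L[ℝ] ℝ) (hG : ∀ u ∈ D, ∀ v ∈ D, 0 ≤ (G u - G v) (u - v)) :
    ∃ z ∈ K, ∀ u ∈ D, 0 ≤ G u (u - z) := by
  have key := hK.inter_iInter_nonempty (fun u : D => {z | 0 ≤ G u (u - z)})
    (fun u => isClosed_le continuous_const ((G u).continuous.comp (by fun_prop))) ?_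
  · obtain ⟨z, hz, hz'⟩ := key
    exact ⟨z, hz, fun u hu => Set.mem_iInter.1 hz' ⟨u, hu⟩⟩
  intro t
  rcases t.eq_empty_or_nonempty with rfl | ht
  · simpa using hKn
  have : Nonempty t := ht.to_subtype
  obtain ⟨w, hw, hw'⟩ := exists_mem_stdSimplex_forall_sum_nonneg
    (fun i j : t => G i.1 ((i.1 : E) - j.1)) (fun i j => by
      have := hG _ i.1.2 _ j.1.2
      simp only [sub_apply, map_sub] at this ⊢
      linarith)
  refine ⟨∑ j : t, w j • ((j : D) : E), hKc.sum_mem (fun i _ => hw.1 i) hw.2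
    (fun i _ => hDK i.1.2), Set.mem_iInter₂.2 fun u hu => ?_⟩
  have h := hw' ⟨u, hu⟩
  have e : ∑ j : t, w j * G u ((u : E) - j.1) = G u (u - ∑ j : t, w j • ((j : D) : E)) := by
    simp only [map_sub, map_sum, map_smul, smul_eq_mul, mul_sub, Finset.sum_sub_distrib,
      ← Finset.sum_mul, hw.2, one_mul]
  rw [e] at h
  exact h

/-! ### Calculus of absolutely continuous functions -/

theorem _root_.LipschitzOnWith.comp_absolutelyContinuousOnInterval {X Y : Type*}
    [PseudoMetricSpace X] [PseudoMetricSpace Y] {g : X → Y} {f : ℝ → X} {K : NNReal} {s : Set X}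
    {a b : ℝ} (hg : LipschitzOnWith K g s) (hf : AbsolutelyContinuousOnInterval f a b)
    (hs : ∀ t ∈ Set.uIcc a b, f t ∈ s) :
    AbsolutelyContinuousOnInterval (fun t => g (f t)) a b := by
  have h0 : Tendsto (fun E : ℕ × (ℕ → ℝ × ℝ) =>
      (K : ℝ) * ∑ i ∈ Finset.range E.1, dist (f (E.2 i).1) (f (E.2 i).2))
      (AbsolutelyContinuousOnInterval.totalLengthFilter ⊓
        𝓟 (AbsolutelyContinuousOnInterval.disjWithin a b)) (𝓝 0) := by
    simpa using Tendsto.const_mul (K : ℝ) hf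
  refine squeeze_zero' (Eventually.of_forall fun E => Finset.sum_nonneg fun i _ => dist_nonneg)
    ?_ h0
  rw [eventually_inf_principal]
  filter_upwards with E hE
  rw [Finset.mul_sum]
  exact Finset.sum_le_sum fun i hi =>
    hg.dist_le_mul _ (hs _ (hE.1 i hi).1) _ (hs _ (hE.1 i hi).2)

theorem absolutelyContinuousOnInterval_sum {ι : Type*} (t : Finset ι) {f : ι → ℝ → ℝ} {a b : ℝ}
    (hf : ∀ i ∈ t, AbsolutelyContinuousOnInterval (f i) a b) :
    AbsolutelyContinuousOnInterval (fun u => ∑ i ∈ t, f i u) a b := by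
  classical
  induction t using Finset.induction_on with
  | empty =>
    simpa using ((LipschitzWith.const' (K := 0) (0 : ℝ)).lipschitzOnWith
      (s := Set.uIcc a b)).absolutelyContinuousOnInterval
  | insert i t hi ih =>
    simp only [Finset.sum_insert hi]
    exact (hf i (by simp)).fun_add (ih fun j hj => hf j (by simp [hj]))

/-- Mean value inequality for absolutely continuous functions. -/
theorem sub_le_mul_sub_of_ae_hasDerivAt_le {f : ℝ → ℝ} {a b m : ℝ} (hab : a ≤ b)
    (hf : AbsolutelyContinuousOnInterval f a b)
    (h : ∀ᵐ t : ℝ, a < t → t < b → ∃ d ≤ m, HasDerivAt f d t) : f b - f a ≤ m * (b - a) := by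
  rw [← hf.integral_deriv_eq_sub]
  have h2 : ∫ _ in a..b, m = m * (b - a) := by simp [mul_comm]
  rw [← h2]
  refine intervalIntegral.integral_mono_ae_restrict hab hf.intervalIntegrable_deriv (by simp) ?_
  rw [← Measure.restrict_congr_set Ioo_ae_eq_Icc]
  refine (ae_restrict_iff' measurableSet_Ioo).2 ?_
  filter_upwards [h] with t ht htI
  obtain ⟨d, hd, hd'⟩ := ht htI.1 htI.2
  simpa only [hd'.deriv] using hd

theorem abs_sub_le_mul_sub_of_ae_hasDerivAt {f : ℝ → ℝ} {a b m : ℝ} (hab : a ≤ b)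
    (hf : AbsolutelyContinuousOnInterval f a b)
    (h : ∀ᵐ t : ℝ, a < t → t < b → ∃ d, |d| ≤ m ∧ HasDerivAt f d t) :
    |f b - f a| ≤ m * (b - a) := by
  have hu := sub_le_mul_sub_of_ae_hasDerivAt_le hab hf (m := m) (h.mono
    fun t h h₁ h₂ => (h h₁ h₂).imp fun d hd => ⟨(abs_le.1 hd.1).2, hd.2⟩)
  have hl := sub_le_mul_sub_of_ae_hasDerivAt_le hab hf.fun_neg (m := m) (h.mono
    fun t h h₁ h₂ => by
      obtain ⟨d, hd, hd'⟩ := h h₁ h₂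
      exact ⟨-d, by linarith [(abs_le.1 hd).1], hd'.neg⟩)
  rw [abs_le]
  exact ⟨by linarith, hu⟩

/-- Composing an absolutely continuous function with a continuously differentiable one, on an
order-connected set containing its values, gives an absolutely continuous function. -/
theorem absolutelyContinuousOnInterval_comp {g g' f : ℝ → ℝ} {s : Set ℝ} (hs : s.OrdConnected)
    (hg : ∀ x ∈ s, HasDerivAt g (g' x) x) (hg' : ContinuousOn g' s) {a b : ℝ}
    (hf : AbsolutelyContinuousOnInterval f a b) (hfs : ∀ t ∈ Set.uIcc a b, f t ∈ s) :
    AbsolutelyContinuousOnInterval (fun t => g (f t)) a b := by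
  obtain ⟨t₁, ht₁, h₁⟩ := isCompact_uIcc.exists_isMinOn Set.nonempty_uIcc hf.continuousOn
  obtain ⟨t₂, ht₂, h₂⟩ := isCompact_uIcc.exists_isMaxOn Set.nonempty_uIcc hf.continuousOn
  have hsub : Set.Icc (f t₁) (f t₂) ⊆ s := hs.out (hfs _ ht₁) (hfs _ ht₂)
  obtain ⟨C, hC⟩ := isCompact_Icc.exists_bound_of_continuousOn (hg'.mono hsub)
  have hlip : LipschitzOnWith (Real.toNNReal C) g (Set.Icc (f t₁) (f t₂)) :=
    (convex_Icc _ _).lipschitzOnWith_of_nnnorm_hasDerivWithin_le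
      (fun x hx => (hg x (hsub hx)).hasDerivWithinAt) fun x hx => by
        rw [← NNReal.coe_le_coe, coe_nnnorm]
        exact (hC x hx).trans (Real.le_coe_toNNReal C)
  exact hlip.comp_absolutelyContinuousOnInterval hf fun t ht => ⟨h₁ ht, h₂ ht⟩

/-- A continuous function that gets from `u` or below to `v` or above crosses the band `[u, v]` from
end to end without leaving it on the way. -/
theorem exists_crossing {d : ℝ → ℝ} {a b u v : ℝ} (hab : a ≤ b) (hd : ContinuousOn d (Set.Icc a b))
    (huv : u < v) (ha : d a ≤ u) (hb : v ≤ d b) :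
    ∃ a' b', a ≤ a' ∧ a' < b' ∧ b' ≤ b ∧ d a' = u ∧ d b' = v ∧
      ∀ t ∈ Set.Icc a' b', u ≤ d t ∧ d t ≤ v := by
  -- `b'` is the first time in `[a, b]` at which `d` reaches `v`,
  -- and `a'` the last time in `[a, b']` at which it is at most `u`.
  have hK : IsCompact (Set.Icc a b ∩ d ⁻¹' Set.Ici v) :=
    isCompact_Icc.of_isClosed_subset (hd.preimage_isClosed_of_isClosed isClosed_Icc isClosed_Ici)
      Set.inter_subset_left
  obtain ⟨b', ⟨hb'I, hb'v⟩, hb'min⟩ := hK.exists_isLeast ⟨b, ⟨hab, le_rfl⟩, hb⟩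
  have hd' : ContinuousOn d (Set.Icc a b') := hd.mono (Set.Icc_subset_Icc_right hb'I.2)
  have hK' : IsCompact (Set.Icc a b' ∩ d ⁻¹' Set.Iic u) :=
    isCompact_Icc.of_isClosed_subset (hd'.preimage_isClosed_of_isClosed isClosed_Icc isClosed_Iic)
      Set.inter_subset_left
  obtain ⟨a', ⟨ha'I, ha'u⟩, ha'max⟩ := hK'.exists_isGreatest ⟨a, ⟨le_rfl, hb'I.1⟩, ha⟩
  have hb'v : v ≤ d b' := hb'v
  have ha'u : d a' ≤ u := ha'u
  have hlt : a' < b' := lt_of_le_of_ne ha'I.2 fun h => by rw [h] at ha'u; linarith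
  have hupper : ∀ t ∈ Set.Icc a' b', d t ≤ v := by
    intro t ht
    by_contra! hv
    -- The value `v` would be attained before `t`.
    obtain ⟨c, hc, hcv⟩ := intermediate_value_Icc (ha'I.1.trans ht.1)
      (hd'.mono (Set.Icc_subset_Icc_right ht.2)) ⟨ha.trans huv.le, hv.le⟩
    have h1 := hb'min ⟨⟨hc.1, hc.2.trans (ht.2.trans hb'I.2)⟩, hcv.ge⟩
    have h2 : c = t := le_antisymm hc.2 (ht.2.trans h1)
    rw [h2] at hcv; linarith
  have hlower : ∀ t ∈ Set.Icc a' b', u ≤ d t := by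
    intro t ht
    by_contra! hu
    obtain ⟨c, hc, hcu⟩ := intermediate_value_Icc ht.2
      (hd'.mono (Set.Icc_subset_Icc_left (ha'I.1.trans ht.1))) ⟨hu.le, huv.le.trans hb'v⟩
    have h1 := ha'max ⟨⟨(ha'I.1.trans ht.1).trans hc.1, hc.2⟩, hcu.le⟩
    have h2 : c = t := le_antisymm (h1.trans ht.1) hc.1
    rw [h2] at hcu; linarith
  exact ⟨a', b', ha'I.1, hlt, hb'I.2, le_antisymm ha'u (hlower a' ⟨le_rfl, hlt.le⟩),
    le_antisymm (hupper b' ⟨hlt.le, le_rfl⟩) hb'v, fun t ht => ⟨hlower t ht, hupper t ht⟩⟩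

/-- A form of Barbalat's lemma: if `x' = k (φ - g)` with `k` bounded away from `0` and `g` Lipschitz,
and if `x` and `φ` converge, then `g` converges to the limit of `φ`. -/
theorem tendsto_of_tendsto_of_hasDerivAt {x k φ g : ℝ → ℝ} {t₀ x₀ g₀ κ Λ : ℝ} (hκ : 0 < κ)
    (hx : Tendsto x atTop (𝓝 x₀))
    (hac : ∀ a b, t₀ ≤ a → a ≤ b → AbsolutelyContinuousOnInterval x a b)
    (hder : ∀ᵐ t : ℝ, t₀ < t → HasDerivAt x (k t * (φ t - g t)) t)
    (hk : ∀ t, t₀ ≤ t → κ ≤ k t) (hφ : Tendsto φ atTop (𝓝 g₀))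
    (hg : ∀ a b, t₀ ≤ a → a ≤ b → |g b - g a| ≤ Λ * (b - a)) : Tendsto g atTop (𝓝 g₀) := by
  wlog hΛ : 0 < Λ generalizing Λ
  · exact this (Λ := 1) (fun a b ha hab => (hg a b ha hab).trans (by nlinarith)) one_pos
  -- If `g` exceeded `g₀` by `η` at a late time, it would exceed it by `3η/4` for a while,
  -- during which `x` would drop by a fixed amount.
  have upper : ∀ (x φ g : ℝ → ℝ) (x₀ g₀ : ℝ), Tendsto x atTop (𝓝 x₀) →
      (∀ a b, t₀ ≤ a → a ≤ b → AbsolutelyContinuousOnInterval x a b) →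
      (∀ᵐ t : ℝ, t₀ < t → HasDerivAt x (k t * (φ t - g t)) t) → Tendsto φ atTop (𝓝 g₀) →
      (∀ a b, t₀ ≤ a → a ≤ b → |g b - g a| ≤ Λ * (b - a)) → ∀ η > 0, ∀ᶠ t in atTop, g t < g₀ + η := by
    intro x φ g x₀ g₀ hx hac hder hφ hg η hη
    set τ := η / (4 * Λ) with hτ
    have hτ0 : 0 < τ := by positivity
    have hΛτ : Λ * τ = η / 4 := by rw [hτ]; field_simp
    have hdrop : 0 < κ * (η / 2) * τ / 2 := by positivity
    obtain ⟨t₁, ht₁⟩ := eventually_atTop.1 ((hφ.eventually_lt_const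
      (show g₀ < g₀ + η / 4 by linarith)).and (Metric.tendsto_nhds.1 hx _ hdrop))
    filter_upwards [eventually_ge_atTop t₀, eventually_ge_atTop t₁] with t htt₀ htt₁
    by_contra! hgt
    have h := sub_le_mul_sub_of_ae_hasDerivAt_le (m := -(κ * (η / 2)))
      (by linarith : t ≤ t + τ) (hac t (t + τ) htt₀ (by linarith)) (by
        filter_upwards [hder] with u hu htu hut
        refine ⟨_, ?_, hu (htt₀.trans_lt htu)⟩
        have h1 := (abs_le.1 (hg t u htt₀ htu.le)).1
        have h2 := (ht₁ u (htt₁.trans htu.le)).1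
        have h3 := hk u (htt₀.trans htu.le)
        have h4 : Λ * (u - t) ≤ Λ * τ := by gcongr; linarith
        have h5 : φ u - g u ≤ -(η / 2) := by linarith
        nlinarith)
    have h1 := (ht₁ t htt₁).2
    have h2 := (ht₁ (t + τ) (by linarith)).2
    rw [Real.dist_eq, abs_lt] at h1 h2
    have e : -(κ * (η / 2)) * (t + τ - t) = -(κ * (η / 2) * τ) := by ring
    rw [e] at h
    linarith [h1.2, h2.1]
  refine tendsto_order.2 ⟨fun a ha => ?_, fun a ha => ?_⟩
  · have h := upper (fun t => -x t) (fun t => -φ t) (fun t => -g t) (-x₀) (-g₀) hx.neg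
      (fun a b ha hab => (hac a b ha hab).fun_neg)
      (hder.mono fun t ht h => (ht h).neg.congr_deriv (by ring)) hφ.neg
      (fun a b ha hab => by
        have h := hg a b ha hab
        rwa [neg_sub_neg, abs_sub_comm]) (g₀ - a) (sub_pos.2 ha)
    exact h.mono fun t ht => by linarith
  · have h := upper x φ g x₀ g₀ hx hac hder hφ hg (a - g₀) (sub_pos.2 ha)
    exact h.mono fun t ht => by linarith

/-! ### Monotonicity from the Jacobian -/

theorem isOpen_forall_pos {ι : Type*} [Finite ι] : IsOpen {x : ι → ℝ | ∀ i, 0 < x i} := by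
  simp only [Set.ofPred_forall]
  exact isOpen_iInter_of_finite fun i => isOpen_lt continuous_const (continuous_apply i)

/-- A vector field with negative definite symmetrized Jacobian on the positive orthant is strictly
monotone decreasing there. -/
theorem sum_mul_sub_neg_of_jacobian {ι : Type*} [Fintype ι] {F : (ι → ℝ) → ι → ℝ}
    (hF : ContDiffOn ℝ 1 F {x | ∀ i, 0 < x i})
    (hJ : ∀ x : ι → ℝ, (∀ i, 0 < x i) → (-(symPart (jacobian F x))).PosDef)
    {x x' : ι → ℝ} (hx : ∀ i, 0 < x i) (hx' : ∀ i, 0 < x' i) (hne : x ≠ x') :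
    ∑ i, (x i - x' i) * (F x i - F x' i) < 0 := by
  classical
  set d := x - x' with hd
  have hpos : ∀ t ∈ Set.Icc (0 : ℝ) 1, ∀ i, 0 < (x' + t • d) i := by
    intro t ht i
    have e : (x' + t • d) i = (1 - t) * x' i + t * x i := by simp [hd]; ring
    rw [e]
    rcases ht.1.eq_or_lt with h | h
    · rw [← h]; simpa using hx' i
    · have := mul_pos h (hx i)
      have := mul_nonneg (sub_nonneg.2 ht.2) (hx' i).le
      linarith
  have hderiv : ∀ t ∈ Set.Icc (0 : ℝ) 1, HasDerivAt (fun t : ℝ => ∑ i, d i * F (x' + t • d) i)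
      (∑ i, d i * fderiv ℝ F (x' + t • d) d i) t := by
    intro t ht
    have h1 : HasFDerivAt F (fderiv ℝ F (x' + t • d)) (x' + t • d) :=
      ((hF.differentiableOn one_ne_zero).differentiableAt
        (isOpen_forall_pos.mem_nhds (hpos t ht))).hasFDerivAt
    have h2 : HasDerivAt (fun t : ℝ => x' + t • d) d t := by
      simpa using ((hasDerivAt_id t).smul_const d).const_add x'
    have h3 := h1.comp_hasDerivAt t h2
    rw [hasDerivAt_pi] at h3
    exact HasDerivAt.fun_sum fun i _ => (h3 i).const_mul (d i)
  obtain ⟨t, ht, hslope⟩ := exists_hasDerivAt_eq_slope _ _ (zero_lt_one' ℝ)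
    (fun t ht => (hderiv t ht).continuousAt.continuousWithinAt)
    (fun t ht => hderiv t (Set.Ioo_subset_Icc_self ht))
  have hval : ∑ i, d i * fderiv ℝ F (x' + t • d) d i = ∑ i, (x i - x' i) * (F x i - F x' i) := by
    rw [hslope]
    simp [hd, mul_sub, Finset.sum_sub_distrib]
  rw [← hval]
  have hposdef := (hJ _ (hpos t (Set.Ioo_subset_Icc_self ht))).dotProduct_mulVec_pos
    (x := d) (sub_ne_zero.2 hne)
  set J := jacobian F (x' + t • d) with hJdef
  have hJd : fderiv ℝ F (x' + t • d) d = J.mulVec d := by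
    rw [hJdef, jacobian, LinearMap.toMatrix'_mulVec]; rfl
  have hsym : d ⬝ᵥ (J.transpose.mulVec d) = d ⬝ᵥ (J.mulVec d) := by
    rw [Matrix.mulVec_transpose, dotProduct_comm, ← Matrix.dotProduct_mulVec]
  have : dotProduct d (J.mulVec d) < 0 := by
    simp only [symPart, star_trivial, Matrix.neg_mulVec, Matrix.smul_mulVec, Matrix.add_mulVec,
      dotProduct_neg, dotProduct_smul, dotProduct_add, hsym, smul_eq_mul] at hposdef
    linarith
  rw [hJd]
  exact this

/-! ### The energy of a single rate -/

/-- The energy `∫_a^x (u - a) / κ(u) du` stored by a rate `x` with gain `κ` around its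
equilibrium value `a`. -/
def rateEnergy (κ : ℝ → ℝ) (a x : ℝ) : ℝ := ∫ u in a..x, (u - a) / κ u

section rateEnergy

variable {κ : ℝ → ℝ} {a : ℝ}

@[simp] theorem rateEnergy_self : rateEnergy κ a a = 0 := by simp [rateEnergy]

theorem continuousOn_sub_div (hκc : ContinuousOn κ (Set.Ioi 0)) (hκ : ∀ u, 0 < u → 0 < κ u) (a : ℝ) :
    ContinuousOn (fun u => (u - a) / κ u) (Set.Ioi 0) :=
  ContinuousOn.div (by fun_prop) hκc fun u hu => (hκ u hu).ne'

theorem uIcc_subset_Ioi {x y : ℝ} (hx : 0 < x) (hy : 0 < y) : Set.uIcc x y ⊆ Set.Ioi 0 :=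
  fun _ hz => (lt_min hx hy).trans_le hz.1

theorem hasDerivAt_rateEnergy (ha : 0 < a) (hκc : ContinuousOn κ (Set.Ioi 0))
    (hκ : ∀ u, 0 < u → 0 < κ u) {x : ℝ} (hx : 0 < x) :
    HasDerivAt (rateEnergy κ a) ((x - a) / κ x) x := by
  have hc := continuousOn_sub_div hκc hκ a
  refine intervalIntegral.integral_hasDerivAt_right
    ((hc.mono (uIcc_subset_Ioi ha hx)).intervalIntegrable) ?_ (hc.continuousAt (Ioi_mem_nhds hx))
  exact hc.stronglyMeasurableAtFilter isOpen_Ioi x hx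

theorem continuousOn_rateEnergy (ha : 0 < a) (hκc : ContinuousOn κ (Set.Ioi 0))
    (hκ : ∀ u, 0 < u → 0 < κ u) : ContinuousOn (rateEnergy κ a) (Set.Ioi 0) := fun _ hx =>
  (hasDerivAt_rateEnergy ha hκc hκ hx).continuousAt.continuousWithinAt

theorem strictMonoOn_rateEnergy (ha : 0 < a) (hκc : ContinuousOn κ (Set.Ioi 0))
    (hκ : ∀ u, 0 < u → 0 < κ u) : StrictMonoOn (rateEnergy κ a) (Set.Ici a) := by
  refine strictMonoOn_of_deriv_pos (convex_Ici a)
    ((continuousOn_rateEnergy ha hκc hκ).mono fun x hx => ha.trans_le hx) fun x hx => ?_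
  rw [interior_Ici] at hx
  have hx0 : 0 < x := ha.trans hx
  rw [(hasDerivAt_rateEnergy ha hκc hκ hx0).deriv]
  exact div_pos (sub_pos.2 hx) (hκ x hx0)

theorem strictAntiOn_rateEnergy (ha : 0 < a) (hκc : ContinuousOn κ (Set.Ioi 0))
    (hκ : ∀ u, 0 < u → 0 < κ u) : StrictAntiOn (rateEnergy κ a) (Set.Ioc 0 a) := by
  refine strictAntiOn_of_deriv_neg (convex_Ioc 0 a)
    ((continuousOn_rateEnergy ha hκc hκ).mono fun x hx => hx.1) fun x hx => ?_
  rw [interior_Ioc] at hx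
  rw [(hasDerivAt_rateEnergy ha hκc hκ hx.1).deriv]
  exact div_neg_of_neg_of_pos (sub_neg.2 hx.2) (hκ x hx.1)

theorem rateEnergy_nonneg (ha : 0 < a) (hκc : ContinuousOn κ (Set.Ioi 0))
    (hκ : ∀ u, 0 < u → 0 < κ u) {x : ℝ} (hx : 0 < x) : 0 ≤ rateEnergy κ a x := by
  rw [← rateEnergy_self (κ := κ) (a := a)]
  rcases le_total a x with h | h
  · exact (strictMonoOn_rateEnergy ha hκc hκ).monotoneOn Set.self_mem_Ici h h
  · exact (strictAntiOn_rateEnergy ha hκc hκ).antitoneOn ⟨hx, h⟩ ⟨ha, le_rfl⟩ h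

/-- Sublevel sets of the rate energy shrink to `a`. -/
theorem exists_forall_rateEnergy_lt (ha : 0 < a) (hκc : ContinuousOn κ (Set.Ioi 0))
    (hκ : ∀ u, 0 < u → 0 < κ u) {ε : ℝ} (hε : 0 < ε) :
    ∃ m > 0, ∀ x, 0 < x → rateEnergy κ a x < m → |x - a| < ε := by
  obtain ⟨η, hη, hηε, hηa⟩ : ∃ η > 0, η ≤ ε ∧ η < a :=
    ⟨min ε (a / 2), lt_min hε (by linarith), min_le_left _ _,
      (min_le_right _ _).trans_lt (by linarith)⟩
  have hmono := strictMonoOn_rateEnergy ha hκc hκ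
  have hanti := strictAntiOn_rateEnergy ha hκc hκ
  refine ⟨min (rateEnergy κ a (a + η)) (rateEnergy κ a (a - η)), lt_min ?_ ?_, fun x hx h => ?_⟩
  · rw [← rateEnergy_self (κ := κ) (a := a)]
    exact hmono Set.self_mem_Ici (Set.mem_Ici.2 (by linarith)) (by linarith)
  · rw [← rateEnergy_self (κ := κ) (a := a)]
    exact hanti ⟨by linarith, by linarith⟩ ⟨ha, le_rfl⟩ (by linarith)
  · rw [lt_min_iff] at h
    rw [abs_lt]
    constructor
    · by_contra! hc
      exact (hanti.antitoneOn (a := x) (b := a - η) ⟨hx, by linarith⟩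
        ⟨by linarith, by linarith⟩ (by linarith)).not_gt h.2
    · by_contra! hc
      exact (hmono.monotoneOn (a := a + η) (b := x) (Set.mem_Ici.2 (by linarith))
        (Set.mem_Ici.2 (by linarith)) (by linarith)).not_gt h.1

theorem tendsto_rateEnergy_atTop (ha : 0 < a) (hκc : ContinuousOn κ (Set.Ioi 0))
    (hκ : ∀ u, 0 < u → 0 < κ u)
    (h : Tendsto (fun b : ℝ => ∫ u in (1 : ℝ)..b, u / κ u) atTop atTop) :
    Tendsto (rateEnergy κ a) atTop atTop := by
  have hc := continuousOn_sub_div hκc hκ a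
  have hc' : ContinuousOn (fun u => u / κ u) (Set.Ioi 0) := by
    simpa using continuousOn_sub_div hκc hκ 0
  set c := 2 * a with hcdef
  have hc0 : 0 < c := by linarith
  refine tendsto_atTop_mono' _ ?_ (tendsto_atTop_add_const_left _ (rateEnergy κ a c)
    (((tendsto_atTop_add_const_left _ (-∫ u in (1 : ℝ)..c, u / κ u) h)).const_mul_atTop
      (by norm_num : (0 : ℝ) < 1 / 2)))
  filter_upwards [eventually_ge_atTop c] with x hx
  have hx0 := hc0.trans_le hx
  have hi : IntervalIntegrable (fun u => (u - a) / κ u) volume c x :=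
    (hc.mono (uIcc_subset_Ioi hc0 hx0)).intervalIntegrable
  have hi' : IntervalIntegrable (fun u => u / κ u) volume c x :=
    (hc'.mono (uIcc_subset_Ioi hc0 hx0)).intervalIntegrable
  have e1 : rateEnergy κ a x = rateEnergy κ a c + ∫ u in c..x, (u - a) / κ u :=
    (intervalIntegral.integral_add_adjacent_intervals
      (hc.mono (uIcc_subset_Ioi ha hc0)).intervalIntegrable hi).symm
  have e2 : (∫ u in (1 : ℝ)..x, u / κ u) = (∫ u in (1 : ℝ)..c, u / κ u) + ∫ u in c..x, u / κ u :=
    (intervalIntegral.integral_add_adjacent_intervals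
      (hc'.mono (uIcc_subset_Ioi one_pos hc0)).intervalIntegrable hi').symm
  have h3 : ∫ u in c..x, 1 / 2 * (u / κ u) ≤ ∫ u in c..x, (u - a) / κ u := by
    refine intervalIntegral.integral_mono_on hx (hi'.const_mul _) hi fun u hu => ?_
    have hκu := hκ u (hc0.trans_le hu.1)
    rw [← mul_div_assoc]
    exact div_le_div_of_nonneg_right (by linarith [hu.1]) hκu.le
  rw [intervalIntegral.integral_const_mul] at h3
  rw [e1, e2]
  linarith

end rateEnergy

/-! ### Projection onto nonnegative values -/

theorem proj_of_pos {a x : ℝ} (hx : 0 < x) : proj a x = a := if_pos hx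

theorem abs_proj_le (a x : ℝ) : |proj a x| ≤ |a| := by
  unfold proj
  split_ifs
  · exact le_rfl
  · rcases le_total 0 a with h | h <;> simp [h]

/-- Projection only helps: it acts where `x = 0` and only towards larger `x`. -/
theorem sub_mul_proj_le {a x y : ℝ} (hx : 0 ≤ x) (hy : 0 ≤ y) :
    (x - y) * proj a x ≤ (x - y) * a := by
  rcases hx.eq_or_lt with h | h
  · have h1 : proj a x = max 0 a := if_neg (by rw [← h]; exact lt_irrefl 0)
    rw [h1, ← h]
    nlinarith [le_max_right 0 a]
  · rw [proj_of_pos h]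

variable {L S : Type*} {ρ : S → Type*}

namespace Network

/-! ### Equilibria and their uniqueness -/

section linear

variable [Fintype L] [Fintype S] [∀ s, Fintype (ρ s)] (N : Network L S ρ)

theorem sum_mul_q (a : ∀ s, ρ s → ℝ) (p : L → ℝ) :
    ∑ r : Σ s, ρ s, a r.1 r.2 * N.q p r.1 r.2 = ∑ l, N.y a l * p l := by
  simp only [q, y, Finset.mul_sum, Finset.sum_mul]
  rw [Finset.sum_comm]
  exact Finset.sum_congr rfl fun l _ => Finset.sum_congr rfl fun r _ => by ring

omit [Fintype S] [∀ s, Fintype (ρ s)] in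
theorem q_sub (p p' : L → ℝ) (s : S) (r : ρ s) : N.q (p - p') s r = N.q p s r - N.q p' s r := by
  simp [q, mul_sub, Finset.sum_sub_distrib]

omit [Fintype L] in
theorem y_sub (x x' : ∀ s, ρ s → ℝ) (l : L) : N.y (x - x') l = N.y x l - N.y x' l := by
  simp [y, mul_sub, Finset.sum_sub_distrib]

omit [Fintype S] [∀ s, Fintype (ρ s)] in
theorem le_q_const {Q : ℝ} (hQ : 0 ≤ Q) (s : S) (r : ρ s) : Q ≤ N.q (fun _ => Q) s r := by
  obtain ⟨l, hl⟩ := N.links_nonempty s r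
  have h := Finset.single_le_sum (f := fun l => N.H l ⟨s, r⟩ * Q)
    (fun i _ => mul_nonneg (by simp only [H, Matrix.of_apply]; split_ifs <;> norm_num) hQ)
    (Finset.mem_univ l)
  simpa [H, hl, q] using h

omit [Fintype S] [∀ s, Fintype (ρ s)] in
theorem continuous_q (s : S) (r : ρ s) : Continuous fun p => N.q p s r := by
  unfold q; fun_prop

omit [Fintype L] in
theorem continuous_y (l : L) : Continuous fun x => N.y x l := by
  unfold y; fun_prop

/-- With full row rank, link prices are a continuous (linear) function of the route prices. -/
theorem exists_continuous_leftInverse_q (hH : N.H.rank = Fintype.card L) :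
    ∃ g : (∀ s, ρ s → ℝ) → L → ℝ, Continuous g ∧ ∀ p, g (N.q p) = p := by
  let Q : (L → ℝ) →ₗ[ℝ] (∀ s, ρ s → ℝ) :=
    { toFun := N.q
      map_add' := fun p p' => by
        ext s r; simp [q, mul_add, Finset.sum_add_distrib]
      map_smul' := fun c p => by
        ext s r; simp only [q, Pi.smul_apply, smul_eq_mul, Finset.mul_sum, RingHom.id_apply]
        exact Finset.sum_congr rfl fun l _ => by ring }
  have hrows : LinearIndependent ℝ N.H.row := by
    rw [linearIndependent_iff_card_eq_finrank_span, Set.finrank,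
      ← Matrix.rank_eq_finrank_span_row, hH]
  have hinj : LinearMap.ker Q = ⊥ := by
    rw [LinearMap.ker_eq_bot']
    intro p hp
    funext l
    refine Fintype.linearIndependent_iff.1 hrows p ?_ l
    funext r
    have : N.q p r.1 r.2 = 0 := congrFun (congrFun hp r.1) r.2
    simpa [q, mul_comm] using this
  obtain ⟨g, hg⟩ := LinearMap.exists_leftInverse_of_injective Q hinj
  exact ⟨g, LinearMap.continuous_of_finiteDimensional g, fun p => LinearMap.congr_fun hg p⟩

end linear

section static

variable [Fintype L] [Fintype S] [∀ s, Fintype (ρ s)] {N : Network L S ρ}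

omit [Fintype L] [Fintype S] in
theorem C2.continuousAt_Φ (h2 : N.C2) {x : ∀ s, ρ s → ℝ} {s : S} (hx : ∀ r, 0 < x s r) (r : ρ s) :
    ContinuousAt (fun x : ∀ s, ρ s → ℝ => N.Φ s (x s) r) x := by
  have h : ContinuousAt (N.Φ s) (x s) :=
    (h2 s).2.1.continuousOn.continuousAt (isOpen_forall_pos.mem_nhds hx)
  exact (continuous_apply r).continuousAt.comp (h.comp (continuous_apply s).continuousAt)

/-- On positive rates, passing to real values in `Φ` loses nothing. -/
theorem C3.coe_Φ (h3 : N.C3) {s : S} {x : ρ s → ℝ} (hx : ∀ r, 0 ≤ x r) {r : ρ s} (hr : 0 < x r) :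
    (N.Φ s x r : EReal) = N.φ s r x :=
  EReal.coe_toReal (fun h => hr.ne' ((h3.1 s r x hx).1 h)) (N.φ_ne_bot s r x hx)

omit [Fintype L] in
/-- `-Φ` is strictly monotone on positive rates. -/
theorem C2.sum_mul_sub_Φ_neg (h2 : N.C2) {x x' : ∀ s, ρ s → ℝ} (hx : ∀ s r, 0 < x s r)
    (hx' : ∀ s r, 0 < x' s r) (hne : x ≠ x') :
    ∑ r : Σ s, ρ s, (x r.1 r.2 - x' r.1 r.2) * (N.Φ r.1 (x r.1) r.2 - N.Φ r.1 (x' r.1) r.2) < 0 := by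
  rw [Fintype.sum_sigma]
  obtain ⟨s, hs⟩ := Function.ne_iff.1 hne
  have hlt : ∀ s, x s ≠ x' s → _ := fun s hs =>
    sum_mul_sub_neg_of_jacobian (h2 s).2.1 (h2 s).2.2 (hx s) (hx' s) hs
  refine Finset.sum_neg' (fun s _ => ?_) ⟨s, Finset.mem_univ s, hlt s hs⟩
  by_cases h : x s = x' s
  · simp [h]
  · exact (hlt s h).le

omit [Fintype L] in
theorem C2.sum_mul_sub_Φ_nonpos (h2 : N.C2) {x x' : ∀ s, ρ s → ℝ} (hx : ∀ s r, 0 < x s r)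
    (hx' : ∀ s r, 0 < x' s r) :
    ∑ r : Σ s, ρ s, (x r.1 r.2 - x' r.1 r.2) * (N.Φ r.1 (x r.1) r.2 - N.Φ r.1 (x' r.1) r.2) ≤ 0 := by
  by_cases h : x = x'
  · simp [h]
  · exact (h2.sum_mul_sub_Φ_neg hx hx' h).le

theorem IsEquilibrium.rate_pos (h3 : N.C3) {e : (∀ s, ρ s → ℝ) × (L → ℝ)} (he : N.IsEquilibrium e)
    (s : S) (r : ρ s) : 0 < e.1 s r := by
  refine lt_of_le_of_ne (he.1 s r).1 fun h => ?_
  have h' := (he.1 s r).2.1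
  rw [(h3.1 s r _ fun i => (he.1 s i).1).2 h.symm] at h'
  exact EReal.coe_ne_top _ (top_le_iff.1 h')

theorem IsEquilibrium.Φ_eq (h3 : N.C3) {e : (∀ s, ρ s → ℝ) × (L → ℝ)} (he : N.IsEquilibrium e)
    (s : S) (r : ρ s) : N.Φ s (e.1 s) r = N.q e.2 s r := by
  have hr := he.rate_pos h3 s r
  have := h3.coe_Φ (fun i => (he.1 s i).1) hr
  rw [(he.1 s r).2.2 hr] at this
  exact_mod_cast this

/-- The link conditions as a variational inequality: complementary slackness holds against every
nonnegative test price. -/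
theorem IsEquilibrium.mul_link_nonpos {e : (∀ s, ρ s → ℝ) × (L → ℝ)} (he : N.IsEquilibrium e)
    {p : ℝ} (hp : 0 ≤ p) (l : L) : (p - e.2 l) * (N.y e.1 l - N.c l) ≤ 0 := by
  obtain ⟨h0, hle, heq⟩ := he.2 l
  rcases h0.eq_or_lt with h | h
  · rw [← h, sub_zero]
    exact mul_nonpos_of_nonneg_of_nonpos hp (sub_nonpos.2 hle)
  · simp [heq h]

theorem IsEquilibrium.eq (h2 : N.C2) (h3 : N.C3) {e e' : (∀ s, ρ s → ℝ) × (L → ℝ)}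
    (he : N.IsEquilibrium e) (he' : N.IsEquilibrium e') : e' = e := by
  have hx : e'.1 = e.1 := by
    by_contra hne
    have h := h2.sum_mul_sub_Φ_neg (he'.rate_pos h3) (he.rate_pos h3) hne
    have e1 : ∑ r : Σ s, ρ s, (e'.1 r.1 r.2 - e.1 r.1 r.2) *
        (N.Φ r.1 (e'.1 r.1) r.2 - N.Φ r.1 (e.1 r.1) r.2) =
        ∑ l, (N.y e'.1 l - N.y e.1 l) * (e'.2 l - e.2 l) := by
      simp only [he.Φ_eq h3, he'.Φ_eq h3, ← q_sub]
      have := N.sum_mul_q (e'.1 - e.1) (e'.2 - e.2)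
      simpa only [y_sub, Pi.sub_apply] using this
    rw [e1] at h
    refine h.not_ge (Finset.sum_nonneg fun l _ => ?_)
    have h1 := he.mul_link_nonpos (he'.2 l).1 l
    have h1' := he'.mul_link_nonpos (he.2 l).1 l
    nlinarith
  have hp : e'.2 = e.2 := by
    obtain ⟨g, -, hg⟩ := N.exists_continuous_leftInverse_q h3.2
    rw [← hg e'.2, ← hg e.2]
    congr 1
    funext s r
    rw [← he.Φ_eq h3, ← he'.Φ_eq h3, hx]
  exact Prod.ext hx hp

/-! ### Existence of an equilibrium -/

/-- `z = (x, p)` solves Minty's variational inequality for the operator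
`(x, p) ↦ (q(p) - Φ(x), c - y(x))`, tested on the box `(0, M]^R × [0, M]^L`. Rates of test points are
positive, as `Φ` carries no information where it is infinite. -/
def IsMintySolution (N : Network L S ρ) (M : ℝ) (z : (∀ s, ρ s → ℝ) × (L → ℝ)) : Prop :=
  ∀ (x : ∀ s, ρ s → ℝ) (p : L → ℝ), (∀ s r, 0 < x s r) → (∀ s r, x s r ≤ M) →
    (∀ l, 0 ≤ p l) → (∀ l, p l ≤ M) →
    0 ≤ ∑ r : Σ s, ρ s, (N.q p r.1 r.2 - N.Φ r.1 (x r.1) r.2) * (x r.1 r.2 - z.1 r.1 r.2) +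
      ∑ l, (N.c l - N.y x l) * (p l - z.2 l)

theorem C2.exists_isMintySolution (h2 : N.C2) {M : ℝ} (hM : 0 ≤ M) :
    ∃ z : (∀ s, ρ s → ℝ) × (L → ℝ), (∀ s r, 0 ≤ z.1 s r) ∧ (∀ l, 0 ≤ z.2 l) ∧
      N.IsMintySolution M z := by
  let G : ((∀ s, ρ s → ℝ) × (L → ℝ)) → ((∀ s, ρ s → ℝ) × (L → ℝ)) →L[ℝ] ℝ := fun z =>
    ∑ r : Σ s, ρ s, (N.q z.2 r.1 r.2 - N.Φ r.1 (z.1 r.1) r.2) •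
      ((ContinuousLinearMap.proj r.2).comp ((ContinuousLinearMap.proj r.1).comp
        (ContinuousLinearMap.fst ℝ (∀ s, ρ s → ℝ) (L → ℝ)))) +
    ∑ l, (N.c l - N.y z.1 l) • ((ContinuousLinearMap.proj l).comp
        (ContinuousLinearMap.snd ℝ (∀ s, ρ s → ℝ) (L → ℝ)))
  have hGa : ∀ u v, G u v = ∑ r : Σ s, ρ s, (N.q u.2 r.1 r.2 - N.Φ r.1 (u.1 r.1) r.2) *
      v.1 r.1 r.2 + ∑ l, (N.c l - N.y u.1 l) * v.2 l := fun u v => by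
    simp [G]
  let b : (∀ s, ρ s → ℝ) × (L → ℝ) := (fun _ _ => M, fun _ => M)
  have hb : 0 ≤ b := ⟨fun _ _ => hM, fun _ => hM⟩
  have hmono : ∀ u ∈ {u : (∀ s, ρ s → ℝ) × (L → ℝ) | (∀ s r, 0 < u.1 s r) ∧ u ∈ Set.Icc 0 b},
      ∀ v ∈ {u : (∀ s, ρ s → ℝ) × (L → ℝ) | (∀ s r, 0 < u.1 s r) ∧ u ∈ Set.Icc 0 b},
      0 ≤ (G u - G v) (u - v) := by
    rintro u ⟨hu, -⟩ v ⟨hv, -⟩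
    have h1 := h2.sum_mul_sub_Φ_nonpos hu hv
    have h3 := N.sum_mul_q (u.1 - v.1) (u.2 - v.2)
    simp only [q_sub, y_sub, Pi.sub_apply] at h3
    rw [sub_apply, hGa, hGa]
    have e : ∀ a b c d : ℝ, a + b - (c + d) = (a - c) + (b - d) := fun a b c d => by ring
    rw [e, ← Finset.sum_sub_distrib, ← Finset.sum_sub_distrib]
    have e1 : ∀ r : Σ s, ρ s, (N.q u.2 r.1 r.2 - N.Φ r.1 (u.1 r.1) r.2) * (u - v).1 r.1 r.2 -
        (N.q v.2 r.1 r.2 - N.Φ r.1 (v.1 r.1) r.2) * (u - v).1 r.1 r.2 =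
        (u.1 r.1 r.2 - v.1 r.1 r.2) * (N.q u.2 r.1 r.2 - N.q v.2 r.1 r.2) -
        (u.1 r.1 r.2 - v.1 r.1 r.2) * (N.Φ r.1 (u.1 r.1) r.2 - N.Φ r.1 (v.1 r.1) r.2) :=
      fun r => by simp only [Prod.fst_sub, Pi.sub_apply]; ring
    have e2 : ∀ l, (N.c l - N.y u.1 l) * (u - v).2 l - (N.c l - N.y v.1 l) * (u - v).2 l =
        -((N.y u.1 l - N.y v.1 l) * (u.2 l - v.2 l)) :=
      fun l => by simp only [Prod.snd_sub, Pi.sub_apply]; ring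
    simp only [e1, e2, Finset.sum_sub_distrib, Finset.sum_neg_distrib]
    rw [h3]
    linarith
  obtain ⟨z, hzK, hz⟩ := exists_minty_solution isCompact_Icc (convex_Icc 0 b)
    (Set.nonempty_Icc.2 hb) (fun u hu => hu.2) G hmono
  refine ⟨z, fun s r => hzK.1.1 s r, fun l => hzK.1.2 l, fun x p hx hxM hp hpM => ?_⟩
  have := hz (x, p) ⟨hx, ⟨fun s r => (hx s r).le, hp⟩, ⟨hxM, hpM⟩⟩
  simpa only [hGa, Prod.fst_sub, Prod.snd_sub, Pi.sub_apply] using this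

/-- In a large enough box there is a Minty solution that does not touch the upper faces. -/
theorem C2.exists_isMintySolution_lt (h2 : N.C2) :
    ∃ (M : ℝ) (z : (∀ s, ρ s → ℝ) × (L → ℝ)), N.IsMintySolution M z ∧
      (∀ s r, 0 ≤ z.1 s r) ∧ (∀ s r, z.1 s r < M) ∧ (∀ l, 0 ≤ z.2 l) ∧ ∀ l, z.2 l < M := by
  -- Small rates `η` leave slack capacity on all links, and high prices `Q` exceed all `φ_r`.
  have hη : ∀ᶠ η : ℝ in 𝓝[>] 0, 0 < η ∧ ∀ l, N.y (fun _ _ => η) l < N.c l := by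
    refine (eventually_mem_nhdsWithin (a := (0 : ℝ)) (s := Set.Ioi 0)).and
      (eventually_all.2 fun l => ?_)
    have hc : Tendsto (fun η : ℝ => N.y (fun _ _ => η) l) (𝓝 0) (𝓝 (N.y (fun _ _ => 0) l)) :=
      ((N.continuous_y l).comp (by fun_prop :
        Continuous fun η : ℝ => (fun _ _ => η : ∀ s, ρ s → ℝ))).tendsto 0
    have h0 : N.y (fun _ _ => 0) l = 0 := by simp [y]
    rw [h0] at hc
    exact (hc.mono_left nhdsWithin_le_nhds).eventually_lt_const (N.c_pos l)
  obtain ⟨η, hη0, hηc⟩ := hη.exists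
  obtain ⟨Q, hQ0, hQ⟩ : ∃ Q : ℝ, 0 ≤ Q ∧ ∀ r : Σ s, ρ s, N.Φ r.1 (fun _ => η) r.2 < Q :=
    ((eventually_ge_atTop 0).and (eventually_all.2 fun r => eventually_gt_atTop _)).exists
  set a : (Σ s, ρ s) → ℝ := fun r => N.q (fun _ => Q) r.1 r.2 - N.Φ r.1 (fun _ => η) r.2 with ha
  set b : L → ℝ := fun l => N.c l - N.y (fun _ _ => η) l with hb
  have ha0 : ∀ r, 0 < a r := fun r => sub_pos.2 ((hQ r).trans_le (N.le_q_const hQ0 _ _))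
  have hb0 : ∀ l, 0 < b l := fun l => sub_pos.2 (hηc l)
  set C : ℝ := ∑ r, a r * η + ∑ l, b l * Q with hC
  obtain ⟨M, hMη, hMQ, hMa, hMb⟩ : ∃ M : ℝ, η ≤ M ∧ Q ≤ M ∧ (∀ r, C < a r * M) ∧ ∀ l, C < b l * M :=
    ((eventually_ge_atTop η).and ((eventually_ge_atTop Q).and
      ((eventually_all.2 fun r => (tendsto_id.const_mul_atTop (ha0 r)).eventually_gt_atTop C).and
      (eventually_all.2 fun l => (tendsto_id.const_mul_atTop (hb0 l)).eventually_gt_atTop C)))).exists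
  obtain ⟨z, hz1, hz2, hz⟩ := h2.exists_isMintySolution (hQ0.trans hMQ)
  have h := hz (fun _ _ => η) (fun _ => Q) (fun _ _ => hη0) (fun _ _ => hMη) (fun _ => hQ0)
    fun _ => hMQ
  have hsum : ∑ r : Σ s, ρ s, a r * z.1 r.1 r.2 + ∑ l, b l * z.2 l ≤ C := by
    simp only [mul_sub, Finset.sum_sub_distrib] at h
    simp only [hC, ha, hb]
    linarith
  have hs1 : ∀ r : Σ s, ρ s, 0 ≤ a r * z.1 r.1 r.2 := fun r => mul_nonneg (ha0 r).le (hz1 _ _)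
  have hs2 : ∀ l, 0 ≤ b l * z.2 l := fun l => mul_nonneg (hb0 l).le (hz2 _)
  have hS1 := Finset.sum_nonneg fun r (_ : r ∈ Finset.univ) => hs1 r
  have hS2 := Finset.sum_nonneg fun r (_ : r ∈ Finset.univ) => hs2 r
  refine ⟨M, z, hz, hz1, fun s r => ?_, hz2, fun l => ?_⟩
  · have := Finset.single_le_sum (fun r _ => hs1 r) (Finset.mem_univ (⟨s, r⟩ : Σ s, ρ s))
    exact lt_of_mul_lt_mul_left (by linarith [hMa ⟨s, r⟩]) (ha0 ⟨s, r⟩).le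
  · have := Finset.single_le_sum (fun r _ => hs2 r) (Finset.mem_univ l)
    exact lt_of_mul_lt_mul_left (by linarith [hMb l]) (hb0 l).le

theorem IsMintySolution.rate_pos (h2 : N.C2) (h3 : N.C3) {M : ℝ} {z : (∀ s, ρ s → ℝ) × (L → ℝ)}
    (hz : N.IsMintySolution M z) (hx0 : ∀ s r, 0 ≤ z.1 s r) (hxM : ∀ s r, z.1 s r < M)
    (hp0 : ∀ l, 0 ≤ z.2 l) (hpM : ∀ l, z.2 l < M) (s : S) (r : ρ s) : 0 < z.1 s r := by
  refine lt_of_le_of_ne (hx0 s r) fun h0 => ?_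
  -- Compare with `z` shifted by `t` in all rates: `φ_r` blows up as `t` tends to `0`.
  let X : ℝ → ∀ s, ρ s → ℝ := fun t s r => z.1 s r + t
  have hXlim : ∀ s, Tendsto (fun t => X t s) (𝓝[>] 0) (𝓝[{x | ∀ i, 0 ≤ x i}] (z.1 s)) := by
    intro s
    refine tendsto_nhdsWithin_iff.2 ⟨?_, ?_⟩
    · have : Continuous fun t => X t s := by unfold X; fun_prop
      have h := (this.tendsto 0).mono_left (nhdsWithin_le_nhds (s := Set.Ioi 0))
      simpa [X] using h
    · filter_upwards [self_mem_nhdsWithin] with t ht i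
      exact add_nonneg (hx0 s i) (le_of_lt ht)
  have hφlim : ∀ s r, Tendsto (fun t => N.φ s r (X t s)) (𝓝[>] 0) (𝓝 (N.φ s r (z.1 s))) :=
    fun s r => ((h2 s).1 r _ (hx0 s)).tendsto.comp (hXlim s)
  have hXpos : ∀ᶠ t in 𝓝[>] (0 : ℝ), ∀ s r, 0 < X t s r := by
    filter_upwards [self_mem_nhdsWithin] with t ht s r
    exact add_pos_of_nonneg_of_pos (hx0 s r) ht
  have hlower : ∀ s r (m : ℝ), (m : EReal) < N.φ s r (z.1 s) →
      ∀ᶠ t in 𝓝[>] 0, m ≤ N.Φ s (X t s) r := by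
    intro s r m hm
    filter_upwards [(hφlim s r).eventually_const_lt hm, hXpos] with t ht htp
    rw [← h3.coe_Φ (fun i => (htp s i).le) (htp s r)] at ht
    exact (EReal.coe_lt_coe_iff.1 ht).le
  have hm : ∀ r : Σ s, ρ s, ∃ m : ℝ, (m : EReal) < N.φ r.1 r.2 (z.1 r.1) := fun r => by
    obtain ⟨m, -, hm⟩ := EReal.lt_iff_exists_real_btwn.1
      (bot_lt_iff_ne_bot.2 (N.φ_ne_bot r.1 r.2 (z.1 r.1) (hx0 r.1)))
    exact ⟨m, hm⟩
  choose m hm using hm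
  set B := ∑ r : Σ s, ρ s, (N.q z.2 r.1 r.2 - m r) + m ⟨s, r⟩ + 1 with hB
  have hbig : ∀ᶠ t in 𝓝[>] 0, B ≤ N.Φ s (X t s) r := hlower s r B (by
    rw [(h3.1 s r _ (hx0 s)).2 h0.symm]; exact EReal.coe_lt_top B)
  have hXM : ∀ᶠ t in 𝓝[>] (0 : ℝ), ∀ r : Σ s, ρ s, X t r.1 r.2 ≤ M := by
    refine eventually_all.2 fun r => ?_
    have : Continuous fun t => X t r.1 r.2 := by unfold X; fun_prop
    have h := (this.tendsto 0).mono_left (nhdsWithin_le_nhds (s := Set.Ioi 0))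
    exact (h.eventually_lt_const (by simpa [X] using hxM r.1 r.2)).mono fun t ht => ht.le
  obtain ⟨t, ⟨⟨⟨ht0, htX⟩, htB⟩, htM⟩, htm⟩ := ((((eventually_mem_nhdsWithin.and hXpos).and
    hbig).and hXM).and (eventually_all.2 fun r : Σ s, ρ s => hlower r.1 r.2 (m r) (hm r))).exists
  have ht0 : 0 < t := ht0
  have h := hz (X t) z.2 htX (fun s r => htM ⟨s, r⟩) hp0 fun l => (hpM l).le
  simp only [sub_self, mul_zero, Finset.sum_const_zero, add_zero, X, add_sub_cancel_left,
    ← Finset.sum_mul] at h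
  have h' := nonneg_of_mul_nonneg_left h ht0
  have hs := Finset.single_le_sum (f := fun r : Σ s, ρ s => N.Φ r.1 (X t r.1) r.2 - m r)
    (fun r _ => sub_nonneg.2 (htm r)) (Finset.mem_univ (⟨s, r⟩ : Σ s, ρ s))
  simp only [Finset.sum_sub_distrib, X] at h' hs hB htB
  linarith

theorem IsMintySolution.Φ_eq (h2 : N.C2) {M : ℝ} {z : (∀ s, ρ s → ℝ) × (L → ℝ)}
    (hz : N.IsMintySolution M z) (hx0 : ∀ s r, 0 < z.1 s r) (hxM : ∀ s r, z.1 s r < M)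
    (hp0 : ∀ l, 0 ≤ z.2 l) (hpM : ∀ l, z.2 l < M) (s : S) (r : ρ s) :
    N.Φ s (z.1 s) r = N.q z.2 s r := by
  let d : ∀ s, ρ s → ℝ := fun s r => N.Φ s (z.1 s) r - N.q z.2 s r
  let X : ℝ → ∀ s, ρ s → ℝ := fun t => z.1 + t • d
  have hXc : Continuous X := by unfold X; fun_prop
  have hX0 : X 0 = z.1 := by simp [X]
  have hXlim : Tendsto X (𝓝[>] 0) (𝓝 z.1) := by
    have h := (hXc.tendsto 0).mono_left (nhdsWithin_le_nhds (s := Set.Ioi 0))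
    rwa [hX0] at h
  have hXr : ∀ s r, Tendsto (fun t => X t s r) (𝓝[>] 0) (𝓝 (z.1 s r)) := fun s r =>
    tendsto_pi_nhds.1 (tendsto_pi_nhds.1 hXlim s) r
  have hlim : Tendsto (fun t => ∑ r : Σ s, ρ s,
      (N.q z.2 r.1 r.2 - N.Φ r.1 (X t r.1) r.2) * d r.1 r.2) (𝓝[>] 0)
      (𝓝 (∑ r : Σ s, ρ s, (N.q z.2 r.1 r.2 - N.Φ r.1 (z.1 r.1) r.2) * d r.1 r.2)) :=
    tendsto_finsetSum _ fun r _ => (tendsto_const_nhds.sub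
      ((h2.continuousAt_Φ (hx0 r.1) r.2).tendsto.comp hXlim)).mul_const _
  have hnonneg : 0 ≤ ∑ r : Σ s, ρ s, (N.q z.2 r.1 r.2 - N.Φ r.1 (z.1 r.1) r.2) * d r.1 r.2 := by
    refine ge_of_tendsto hlim ?_
    have h1 : ∀ᶠ t in 𝓝[>] (0 : ℝ), ∀ r : Σ s, ρ s, 0 < X t r.1 r.2 ∧ X t r.1 r.2 < M :=
      eventually_all.2 fun r => ((hXr r.1 r.2).eventually_const_lt (hx0 r.1 r.2)).and
        ((hXr r.1 r.2).eventually_lt_const (hxM r.1 r.2))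
    filter_upwards [h1, self_mem_nhdsWithin] with t ht ht0
    have ht0 : 0 < t := ht0
    have h := hz (X t) z.2 (fun s r => (ht ⟨s, r⟩).1) (fun s r => (ht ⟨s, r⟩).2.le) hp0
      fun l => (hpM l).le
    have e : ∀ r : Σ s, ρ s, X t r.1 r.2 - z.1 r.1 r.2 = d r.1 r.2 * t := fun r => by
      simp [X, mul_comm]
    simp only [sub_self, mul_zero, Finset.sum_const_zero, add_zero, e, ← mul_assoc,
      ← Finset.sum_mul] at h
    exact nonneg_of_mul_nonneg_left h ht0
  have hsq : ∑ r : Σ s, ρ s, d r.1 r.2 ^ 2 ≤ 0 := by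
    have e : ∀ r : Σ s, ρ s, (N.q z.2 r.1 r.2 - N.Φ r.1 (z.1 r.1) r.2) * d r.1 r.2 =
        -(d r.1 r.2 ^ 2) := fun r => by simp only [d]; ring
    simp only [e, Finset.sum_neg_distrib] at hnonneg
    linarith
  have h0 := (Finset.sum_eq_zero_iff_of_nonneg fun r _ => sq_nonneg _).1
    (le_antisymm hsq (Finset.sum_nonneg fun r _ => sq_nonneg _)) ⟨s, r⟩ (Finset.mem_univ _)
  exact sub_eq_zero.1 (pow_eq_zero_iff two_ne_zero |>.1 h0)

theorem exists_isEquilibrium (h2 : N.C2) (h3 : N.C3) : ∃ e, N.IsEquilibrium e := by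
  classical
  obtain ⟨M, z, hz, hx0, hxM, hp0, hpM⟩ := h2.exists_isMintySolution_lt
  have hxpos := hz.rate_pos h2 h3 hx0 hxM hp0 hpM
  have hΦ := hz.Φ_eq h2 hxpos hxM hp0 hpM
  have hlink : ∀ l (v : ℝ), 0 ≤ v → v ≤ M → 0 ≤ (N.c l - N.y z.1 l) * (v - z.2 l) := by
    intro l v hv hvM
    have h := hz z.1 (Function.update z.2 l v) hxpos (fun s r => (hxM s r).le)
      (fun i => by by_cases hi : i = l <;> simp [hi, hv, hp0])
      (fun i => by by_cases hi : i = l <;> simp [hi, hvM, (hpM _).le])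
    simp only [sub_self, mul_zero, Finset.sum_const_zero, zero_add] at h
    rw [Finset.sum_eq_single l (fun i _ hi => by simp [hi]) (by simp)] at h
    simpa using h
  refine ⟨z, fun s r => ⟨hx0 s r, ?_, fun _ => ?_⟩, fun l => ⟨hp0 l, ?_, fun hpos => ?_⟩⟩
  · rw [← hΦ, h3.coe_Φ (hx0 s) (hxpos s r)]
  · rw [← hΦ, h3.coe_Φ (hx0 s) (hxpos s r)]
  · have h := hlink l M ((hp0 l).trans (hpM l).le) le_rfl
    linarith [nonneg_of_mul_nonneg_left h (sub_pos.2 (hpM l))]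
  · have h := hlink l M ((hp0 l).trans (hpM l).le) le_rfl
    have h1 := nonneg_of_mul_nonneg_left h (sub_pos.2 (hpM l))
    have h2 := hlink l 0 le_rfl ((hp0 l).trans (hpM l).le)
    nlinarith

end static

/-! ### Positivity of the rates along trajectories -/

variable [Fintype L] [Fintype S] [∀ s, Fintype (ρ s)] {N : Network L S ρ}

section trajectory

variable {T : EReal} {z : ℝ → (∀ s, ρ s → ℝ) × (L → ℝ)}

theorem IsTrajectory.continuousOn (hz : N.IsTrajectory T z) {b : ℝ} (hb : 0 ≤ b)
    (hbT : (b : EReal) < T) : ContinuousOn z (Set.Icc 0 b) := by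
  rw [← Set.uIcc_of_le hb]
  have h1 : ContinuousOn (fun t => (z t).1) (Set.uIcc 0 b) := continuousOn_pi.2 fun s =>
    continuousOn_pi.2 fun r => (hz.rate_ac b hb hbT s r).continuousOn
  have h2 : ContinuousOn (fun t => (z t).2) (Set.uIcc 0 b) := continuousOn_pi.2 fun l =>
    (hz.price_ac b hb hbT l).continuousOn
  exact h1.prodMk h2

/-- Rates are positive at all positive times, not just at almost all of them. -/
theorem IsTrajectory.rate_pos (hz : N.IsTrajectory T z) (h2 : N.C2) (h3 : N.C3) {t : ℝ}
    (ht : 0 < t) (htT : (t : EReal) < T) (s : S) (r : ρ s) : 0 < (z t).1 s r := by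
  refine lt_of_le_of_ne (hz.rate_nonneg t ht.le htT s r) fun h0 => ?_
  have hlt : ∀ u ≤ t, (u : EReal) < T := fun u hu => (EReal.coe_le_coe_iff.2 hu).trans_lt htT
  have hcont := hz.continuousOn ht.le htT t ⟨ht.le, le_rfl⟩
  -- Just before `t` the function `φ_r` exceeds the route price, so that `x_r` increases to `0`.
  have hφ : Tendsto (fun u => N.φ s r ((z u).1 s)) (𝓝[Set.Icc 0 t] t) (𝓝 ⊤) := by
    have h := (h2 s).1 r ((z t).1 s) (hz.rate_nonneg t ht.le htT s)
    rw [ContinuousWithinAt, (h3.1 s r _ (hz.rate_nonneg t ht.le htT s)).2 h0.symm] at h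
    refine h.comp (tendsto_nhdsWithin_iff.2 ⟨?_, ?_⟩)
    · exact ((continuous_apply s).tendsto _).comp ((continuous_fst.tendsto _).comp hcont)
    · filter_upwards [self_mem_nhdsWithin] with u hu
      exact hz.rate_nonneg u hu.1 (hlt u hu.2) s
  have hq : Tendsto (fun u => N.q (z u).2 s r) (𝓝[Set.Icc 0 t] t) (𝓝 (N.q (z t).2 s r)) :=
    ((N.continuous_q s r).tendsto _).comp ((continuous_snd.tendsto _).comp hcont)
  have hev : ∀ᶠ u in 𝓝[Set.Icc 0 t] t, (N.q (z u).2 s r : EReal) < N.φ s r ((z u).1 s) := by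
    filter_upwards [hφ.eventually_const_lt (EReal.coe_lt_top (N.q (z t).2 s r + 1)),
      hq.eventually_lt_const (lt_add_one _)] with u hu hu'
    exact (EReal.coe_lt_coe_iff.2 hu').trans hu
  rw [nhdsWithin_Icc_eq_nhdsLE ht] at hev
  obtain ⟨c, hc, hcs⟩ := (mem_nhdsLE_iff_exists_mem_Ico_Ioc_subset ht).1 hev
  have hc0 : 0 ≤ c := hc.1
  have hct : c < t := hc.2
  have hae : ∀ᵐ u : ℝ, c < u → u < t → ∃ d ≤ 0, HasDerivAt (fun τ => -(z τ).1 s r) d u := by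
    filter_upwards [hz.rate_eq] with u hu hcu hut
    have hu' := hu (hc0.trans_lt hcu) (hlt u hut.le)
    refine ⟨_, ?_, (hu' s r).2.neg⟩
    rw [proj_of_pos (hu' s r).1, neg_nonpos]
    refine mul_nonneg (N.k_pos s r _ fun i => (hu' s i).1).le (sub_nonneg.2 ?_)
    have h : (N.q (z u).2 s r : EReal) < N.φ s r ((z u).1 s) := hcs ⟨hcu, hut.le⟩
    rw [← h3.coe_Φ (fun i => (hu' s i).1.le) (hu' s r).1] at h
    exact (EReal.coe_lt_coe_iff.1 h).le
  have hle : ∀ u, c < u → u < t → (z u).1 s r ≤ 0 := by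
    intro u hcu hut
    have hac := (hz.rate_ac t ht.le htT s r).fun_neg.mono (c := u) (d := t) (by
      rw [Set.uIcc_of_le hut.le, Set.uIcc_of_le ht.le]
      exact Set.Icc_subset_Icc_left (hc0.trans hcu.le))
    have h := sub_le_mul_sub_of_ae_hasDerivAt_le hut.le hac (m := 0)
      (hae.mono fun v hv h1 h2 => hv (hcu.trans h1) h2)
    rw [← h0] at h
    linarith
  have hnull : volume (Set.Ioo c t) = 0 := by
    refine measure_mono_null (fun u hu => ?_) (ae_iff.1 hz.rate_eq)
    exact fun h => (h (hc0.trans_lt hu.1) (hlt u hu.2.le) s r).1.not_ge (hle u hu.1 hu.2)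
  rw [Real.volume_Ioo, ENNReal.ofReal_eq_zero] at hnull
  linarith

theorem IsTrajectory.rate_ac_of_le (hz : N.IsTrajectory T z) {a b : ℝ} (ha : 0 ≤ a) (hab : a ≤ b)
    (hbT : (b : EReal) < T) (s : S) (r : ρ s) :
    AbsolutelyContinuousOnInterval (fun t => (z t).1 s r) a b :=
  (hz.rate_ac b (ha.trans hab) hbT s r).mono (by
    rw [Set.uIcc_of_le hab, Set.uIcc_of_le (ha.trans hab)]; exact Set.Icc_subset_Icc_left ha)

theorem IsTrajectory.price_ac_of_le (hz : N.IsTrajectory T z) {a b : ℝ} (ha : 0 ≤ a) (hab : a ≤ b)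
    (hbT : (b : EReal) < T) (l : L) :
    AbsolutelyContinuousOnInterval (fun t => (z t).2 l) a b :=
  (hz.price_ac b (ha.trans hab) hbT l).mono (by
    rw [Set.uIcc_of_le hab, Set.uIcc_of_le (ha.trans hab)]; exact Set.Icc_subset_Icc_left ha)

end trajectory

/-! ### Energy and dissipation -/

/-- The gain `k_r` as a function of the rate of route `r` alone, read off on the diagonal; this is
the gain itself when gains depend on their own rate only. -/
def gain (N : Network L S ρ) (s : S) (r : ρ s) (u : ℝ) : ℝ := N.k s r fun _ => u

omit [Fintype L] [Fintype S] [∀ s, Fintype (ρ s)] in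
theorem gain_pos (N : Network L S ρ) (s : S) (r : ρ s) (u : ℝ) (hu : 0 < u) : 0 < N.gain s r u :=
  N.k_pos s r _ fun _ => hu

omit [Fintype L] [Fintype S] [∀ s, Fintype (ρ s)] in
theorem continuousOn_gain (N : Network L S ρ) (s : S) (r : ρ s) :
    ContinuousOn (N.gain s r) (Set.Ioi 0) :=
  (N.k_continuousOn s r).comp (by fun_prop) fun _ hu _ => hu

/-- The Lyapunov function: the energy of the state `z` relative to the equilibrium `e`. It is
meaningful for positive rates, where the integrands are continuous. -/
def energy (N : Network L S ρ) (e z : (∀ s, ρ s → ℝ) × (L → ℝ)) : ℝ :=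
  ∑ r : Σ s, ρ s, rateEnergy (N.gain r.1 r.2) (e.1 r.1 r.2) (z.1 r.1 r.2) +
    ∑ l, (z.2 l - e.2 l) ^ 2 / (2 * N.γ l)

/-- The rate `(x - x₀) · (Φ(x₀) - Φ(x))` at which energy is lost at rates `x`. -/
def dissipation (N : Network L S ρ) (x₀ x : ∀ s, ρ s → ℝ) : ℝ :=
  ∑ r : Σ s, ρ s, (x r.1 r.2 - x₀ r.1 r.2) * (N.Φ r.1 (x₀ r.1) r.2 - N.Φ r.1 (x r.1) r.2)

/-- Energy is lost at least at the rate of dissipation. The positivity assumption at the left end is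
automatic for `a > 0`; at `a = 0` rates may vanish, and the energy may be meaningless. -/
theorem IsEquilibrium.energy_sub_le (h2 : N.C2) (h3 : N.C3) (hk : N.GainOfOwnRate)
    {e : (∀ s, ρ s → ℝ) × (L → ℝ)} (he : N.IsEquilibrium e) {T : EReal}
    {z : ℝ → (∀ s, ρ s → ℝ) × (L → ℝ)} (hz : N.IsTrajectory T z) {a b w : ℝ} (ha : 0 ≤ a)
    (hpos : ∀ s r, 0 < (z a).1 s r) (hab : a ≤ b) (hbT : (b : EReal) < T)
    (hw : ∀ t ∈ Set.Ioo a b, w ≤ N.dissipation e.1 (z t).1) :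
    N.energy e (z b) - N.energy e (z a) ≤ -w * (b - a) := by
  have hlt : ∀ u ≤ b, (u : EReal) < T := fun u hu => (EReal.coe_le_coe_iff.2 hu).trans_lt hbT
  have hrate := he.rate_pos h3
  have hpos' : ∀ t ∈ Set.uIcc a b, ∀ s r, 0 < (z t).1 s r := by
    intro t ht s r
    rw [Set.uIcc_of_le hab] at ht
    rcases ht.1.eq_or_lt with h | h
    · rw [← h]; exact hpos s r
    · exact hz.rate_pos h2 h3 (ha.trans_lt h) (hlt t ht.2) s r
  have hd1 : ∀ (r : Σ s, ρ s) (x : ℝ), x ∈ Set.Ioi (0 : ℝ) →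
      HasDerivAt (rateEnergy (N.gain r.1 r.2) (e.1 r.1 r.2))
        ((x - e.1 r.1 r.2) / N.gain r.1 r.2 x) x := fun r x hx =>
    hasDerivAt_rateEnergy (hrate r.1 r.2) (N.continuousOn_gain r.1 r.2) (N.gain_pos r.1 r.2) hx
  have hd2 : ∀ (l : L) (p : ℝ), HasDerivAt (fun p => (p - e.2 l) ^ 2 / (2 * N.γ l))
      ((p - e.2 l) / N.γ l) p := fun l p => by
    have h := (((hasDerivAt_id p).sub_const (e.2 l)).pow 2).div_const (2 * N.γ l)
    have hγ := (N.γ_pos l).ne'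
    refine h.congr_deriv ?_
    simp only [id]
    field_simp
    simp [mul_comm]
  refine sub_le_mul_sub_of_ae_hasDerivAt_le (f := fun t => N.energy e (z t)) hab ?_ ?_
  · refine AbsolutelyContinuousOnInterval.fun_add
      (absolutelyContinuousOnInterval_sum _ fun r _ => ?_)
      (absolutelyContinuousOnInterval_sum _ fun l _ => ?_)
    · exact absolutelyContinuousOnInterval_comp Set.ordConnected_Ioi (hd1 r)
        (continuousOn_sub_div (N.continuousOn_gain r.1 r.2) (N.gain_pos r.1 r.2) _)
        (hz.rate_ac_of_le ha hab hbT r.1 r.2) fun t ht => hpos' t ht r.1 r.2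
    · exact absolutelyContinuousOnInterval_comp (g := fun p => (p - e.2 l) ^ 2 / (2 * N.γ l))
        Set.ordConnected_univ (fun p _ => hd2 l p)
        (by fun_prop) (hz.price_ac_of_le ha hab hbT l) fun _ _ => Set.mem_univ _
  · filter_upwards [hz.rate_eq, hz.price_eq] with t hrt hpt hat htb
    have hx := hrt (ha.trans_lt hat) (hlt t htb.le)
    have hp := hpt (ha.trans_lt hat) (hlt t htb.le)
    have hV1 := fun r : Σ s, ρ s =>
      HasDerivAt.comp (h₂ := rateEnergy (N.gain r.1 r.2) (e.1 r.1 r.2)) t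
        (hd1 r _ (hx r.1 r.2).1) (hx r.1 r.2).2
    have hV2 := fun l => HasDerivAt.comp (h₂ := fun p => (p - e.2 l) ^ 2 / (2 * N.γ l)) t
      (hd2 l _) (hp l)
    refine ⟨_, ?_, (HasDerivAt.fun_sum (u := Finset.univ) fun r _ => hV1 r).fun_add
      (HasDerivAt.fun_sum (u := Finset.univ) fun l _ => hV2 l)⟩
    have e1 : ∀ r : Σ s, ρ s, ((z t).1 r.1 r.2 - e.1 r.1 r.2) / N.gain r.1 r.2 ((z t).1 r.1 r.2) *
        (N.k r.1 r.2 ((z t).1 r.1) * proj (N.Φ r.1 ((z t).1 r.1) r.2 - N.q (z t).2 r.1 r.2)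
          ((z t).1 r.1 r.2)) = ((z t).1 r.1 r.2 - e.1 r.1 r.2) * (N.q e.2 r.1 r.2 -
            N.q (z t).2 r.1 r.2) - ((z t).1 r.1 r.2 - e.1 r.1 r.2) * (N.Φ r.1 (e.1 r.1) r.2 -
            N.Φ r.1 ((z t).1 r.1) r.2) := by
      intro r
      have hg : N.gain r.1 r.2 ((z t).1 r.1 r.2) = N.k r.1 r.2 ((z t).1 r.1) :=
        hk r.1 r.2 _ _ (fun _ => (hx r.1 r.2).1) (fun i => (hx r.1 i).1) rfl
      have hk0 := (N.k_pos r.1 r.2 _ fun i => (hx r.1 i).1).ne'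
      rw [hg, proj_of_pos (hx r.1 r.2).1, he.Φ_eq h3]
      field_simp
      ring
    have e2 : ∀ l, ((z t).2 l - e.2 l) / N.γ l *
        (N.γ l * proj (N.y (z t).1 l - N.c l) ((z t).2 l)) ≤
        ((z t).2 l - e.2 l) * (N.y (z t).1 l - N.y e.1 l) := by
      intro l
      have hγ := (N.γ_pos l).ne'
      have h0 := hz.price_nonneg t (ha.trans hat.le) (hlt t htb.le) l
      have h1 := sub_mul_proj_le (a := N.y (z t).1 l - N.c l) h0 (he.2 l).1
      have h2 := he.mul_link_nonpos h0 l
      calc _ = ((z t).2 l - e.2 l) * proj (N.y (z t).1 l - N.c l) ((z t).2 l) := by field_simp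
        _ ≤ _ := by nlinarith
    have e3 := N.sum_mul_q ((z t).1 - e.1) (e.2 - (z t).2)
    simp only [q_sub, y_sub, Pi.sub_apply] at e3
    have e4 := Finset.sum_le_sum fun l (_ : l ∈ Finset.univ) => e2 l
    have e5 : ∑ l, ((z t).2 l - e.2 l) * (N.y (z t).1 l - N.y e.1 l) =
        -∑ l, (N.y (z t).1 l - N.y e.1 l) * (e.2 l - (z t).2 l) := by
      rw [← Finset.sum_neg_distrib]
      exact Finset.sum_congr rfl fun l _ => by ring
    have hdis := hw t ⟨hat, htb⟩
    rw [dissipation] at hdis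
    simp only [e1, Finset.sum_sub_distrib]
    rw [e3]
    linarith

omit [Fintype L] in
theorem dissipation_eq_neg_sum (N : Network L S ρ) (x₀ x : ∀ s, ρ s → ℝ) :
    N.dissipation x₀ x = -∑ r : Σ s, ρ s, (x r.1 r.2 - x₀ r.1 r.2) *
      (N.Φ r.1 (x r.1) r.2 - N.Φ r.1 (x₀ r.1) r.2) := by
  rw [dissipation, ← Finset.sum_neg_distrib]
  exact Finset.sum_congr rfl fun r _ => by ring

omit [Fintype L] in
theorem C2.dissipation_nonneg (h2 : N.C2) {x₀ x : ∀ s, ρ s → ℝ} (hx₀ : ∀ s r, 0 < x₀ s r)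
    (hx : ∀ s r, 0 < x s r) : 0 ≤ N.dissipation x₀ x := by
  rw [dissipation_eq_neg_sum, neg_nonneg]
  exact h2.sum_mul_sub_Φ_nonpos hx hx₀

omit [Fintype L] in
theorem C2.dissipation_pos (h2 : N.C2) {x₀ x : ∀ s, ρ s → ℝ} (hx₀ : ∀ s r, 0 < x₀ s r)
    (hx : ∀ s r, 0 < x s r) (hne : x ≠ x₀) : 0 < N.dissipation x₀ x := by
  rw [dissipation_eq_neg_sum, neg_pos]
  exact h2.sum_mul_sub_Φ_neg hx hx₀ hne

omit [Fintype L] in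
theorem exists_closedBall_rate_pos {x₀ : ∀ s, ρ s → ℝ} (hx₀ : ∀ s r, 0 < x₀ s r) {ε : ℝ}
    (hε : 0 < ε) : ∃ η > 0, η ≤ ε ∧ ∀ x ∈ Metric.closedBall x₀ η, ∀ s r, 0 < x s r := by
  have hopen : ∀ᶠ x in 𝓝 x₀, ∀ r : Σ s, ρ s, 0 < x r.1 r.2 := eventually_all.2 fun r => by
    have h : Continuous fun x : ∀ s, ρ s → ℝ => x r.1 r.2 := by fun_prop
    exact (h.tendsto x₀).eventually_const_lt (hx₀ r.1 r.2)
  obtain ⟨η, hη, hsub⟩ := Metric.nhds_basis_closedBall.eventually_iff.1 hopen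
  exact ⟨min η ε, lt_min hη hε, min_le_right _ _, fun x hx s r =>
    hsub (Metric.closedBall_subset_closedBall (min_le_left _ _) hx) ⟨s, r⟩⟩

omit [Fintype L] in
/-- The dissipation is bounded away from `0` outside each ball around `x₀`, however large or small
the rates are. -/
theorem C2.exists_le_dissipation (h2 : N.C2) {x₀ : ∀ s, ρ s → ℝ} (hx₀ : ∀ s r, 0 < x₀ s r) {ε : ℝ}
    (hε : 0 < ε) : ∃ w > 0, ∀ x : ∀ s, ρ s → ℝ, (∀ s r, 0 < x s r) → ε ≤ dist x x₀ →
      w ≤ N.dissipation x₀ x := by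
  obtain ⟨η, hη, hηε, hball⟩ := exists_closedBall_rate_pos hx₀ hε
  have hsphere : ∃ w > 0, ∀ x ∈ Metric.sphere x₀ η, w ≤ N.dissipation x₀ x := by
    rcases (Metric.sphere x₀ η).eq_empty_or_nonempty with h | h
    · exact ⟨1, one_pos, by simp [h]⟩
    have hc : ContinuousOn (N.dissipation x₀) (Metric.sphere x₀ η) := by
      intro x hx
      refine ContinuousAt.continuousWithinAt ?_
      have hpos := hball x (Metric.sphere_subset_closedBall hx)
      have hcr : ∀ r : Σ s, ρ s, Continuous fun x : ∀ s, ρ s → ℝ => x r.1 r.2 - x₀ r.1 r.2 :=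
        fun r => by fun_prop
      exact tendsto_finsetSum _ fun r _ => ((hcr r).continuousAt.mul
        (continuousAt_const.sub (h2.continuousAt_Φ (hpos r.1) r.2)))
    obtain ⟨m, hm, hmin⟩ := (isCompact_sphere x₀ η).exists_isMinOn h hc
    refine ⟨N.dissipation x₀ m, ?_, hmin⟩
    have hne : m ≠ x₀ := by
      rintro rfl
      simp at hm
      linarith
    exact h2.dissipation_pos hx₀ (hball m (Metric.sphere_subset_closedBall hm)) hne
  obtain ⟨w, hw, hle⟩ := hsphere
  refine ⟨w, hw, fun x hx hdist => ?_⟩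
  -- Along the ray from `x₀` through `x` the dissipation increases, by monotonicity.
  have hn : 0 < dist x x₀ := hε.trans_le hdist
  set lam : ℝ := η / dist x x₀ with hlam
  have hlam0 : 0 < lam := div_pos hη hn
  have hlam1 : lam ≤ 1 := (div_le_one hn).2 (hηε.trans hdist)
  set x₁ : ∀ s, ρ s → ℝ := x₀ + lam • (x - x₀) with hx₁
  have hx₁r : ∀ s r, x₁ s r = x₀ s r + lam * (x s r - x₀ s r) := fun s r => by simp [hx₁]
  have hmem : x₁ ∈ Metric.sphere x₀ η := by
    rw [mem_sphere_iff_norm, hx₁, add_sub_cancel_left, norm_smul, ← dist_eq_norm,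
      Real.norm_of_nonneg hlam0.le, hlam, div_mul_cancel₀ _ hn.ne']
  have hpos₁ := hball x₁ (Metric.sphere_subset_closedBall hmem)
  have h1 := hle x₁ hmem
  have h3 := h2.sum_mul_sub_Φ_nonpos hx hpos₁
  set A := ∑ r : Σ s, ρ s, (x r.1 r.2 - x₀ r.1 r.2) *
    (N.Φ r.1 (x₀ r.1) r.2 - N.Φ r.1 (x₁ r.1) r.2) with hA
  have e1 : N.dissipation x₀ x₁ = lam * A := by
    rw [dissipation, hA, Finset.mul_sum]
    exact Finset.sum_congr rfl fun r _ => by rw [hx₁r]; ring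
  have e3 : ∑ r : Σ s, ρ s, (x r.1 r.2 - x₁ r.1 r.2) *
      (N.Φ r.1 (x r.1) r.2 - N.Φ r.1 (x₁ r.1) r.2) = (1 - lam) * (A - N.dissipation x₀ x) := by
    rw [dissipation, hA, ← Finset.sum_sub_distrib, Finset.mul_sum]
    exact Finset.sum_congr rfl fun r _ => by rw [hx₁r]; ring
  rw [e3] at h3
  have hAw : w ≤ A := by nlinarith
  rcases hlam1.eq_or_lt with h | h
  · have : x₁ = x := by rw [hx₁, h]; simp
    rwa [← this]
  · nlinarith

/-! ### Sublevel sets of the energy and Lyapunov stability -/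

variable {e : (∀ s, ρ s → ℝ) × (L → ℝ)}

theorem rateEnergy_le_energy (he : ∀ s r, 0 < e.1 s r) {z : (∀ s, ρ s → ℝ) × (L → ℝ)}
    (hz : ∀ s r, 0 < z.1 s r) (s : S) (r : ρ s) :
    rateEnergy (N.gain s r) (e.1 s r) (z.1 s r) ≤ N.energy e z := by
  have h1 := Finset.single_le_sum
    (f := fun r : Σ s, ρ s => rateEnergy (N.gain r.1 r.2) (e.1 r.1 r.2) (z.1 r.1 r.2))
    (fun r _ => rateEnergy_nonneg (he r.1 r.2) (N.continuousOn_gain r.1 r.2) (N.gain_pos r.1 r.2)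
      (hz r.1 r.2)) (Finset.mem_univ ⟨s, r⟩)
  have h2 : 0 ≤ ∑ l, (z.2 l - e.2 l) ^ 2 / (2 * N.γ l) := Finset.sum_nonneg fun l _ => by
    have := N.γ_pos l
    positivity
  exact h1.trans (le_add_of_nonneg_right h2)

omit [Fintype L] in
theorem sum_rateEnergy_nonneg {x₀ x : ∀ s, ρ s → ℝ} (hx₀ : ∀ s r, 0 < x₀ s r)
    (hx : ∀ s r, 0 < x s r) :
    0 ≤ ∑ r : Σ s, ρ s, rateEnergy (N.gain r.1 r.2) (x₀ r.1 r.2) (x r.1 r.2) :=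
  Finset.sum_nonneg fun r _ => rateEnergy_nonneg (hx₀ r.1 r.2) (N.continuousOn_gain r.1 r.2)
    (N.gain_pos r.1 r.2) (hx r.1 r.2)

theorem sq_sub_le_energy (he : ∀ s r, 0 < e.1 s r) {z : (∀ s, ρ s → ℝ) × (L → ℝ)}
    (hz : ∀ s r, 0 < z.1 s r) (l : L) : (z.2 l - e.2 l) ^ 2 ≤ 2 * N.γ l * N.energy e z := by
  have h1 := Finset.single_le_sum (f := fun l => (z.2 l - e.2 l) ^ 2 / (2 * N.γ l))
    (fun l _ => by have := N.γ_pos l; positivity) (Finset.mem_univ l)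
  have hγ : 0 < 2 * N.γ l := mul_pos two_pos (N.γ_pos l)
  have h2 : (z.2 l - e.2 l) ^ 2 / (2 * N.γ l) ≤ N.energy e z :=
    h1.trans (le_add_of_nonneg_left (sum_rateEnergy_nonneg he hz))
  rwa [div_le_iff₀' hγ] at h2

theorem energy_nonneg (he : ∀ s r, 0 < e.1 s r) {z : (∀ s, ρ s → ℝ) × (L → ℝ)}
    (hz : ∀ s r, 0 < z.1 s r) : 0 ≤ N.energy e z :=
  add_nonneg (sum_rateEnergy_nonneg he hz) (Finset.sum_nonneg fun l _ => by
    have := N.γ_pos l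
    positivity)

theorem exists_forall_energy_lt (he : ∀ s r, 0 < e.1 s r) {ε : ℝ} (hε : 0 < ε) :
    ∃ m > 0, ∀ z : (∀ s, ρ s → ℝ) × (L → ℝ), (∀ s r, 0 < z.1 s r) → N.energy e z < m →
      dist z e < ε := by
  have h1 : ∀ r : Σ s, ρ s, ∃ m > 0, ∀ x, 0 < x →
      rateEnergy (N.gain r.1 r.2) (e.1 r.1 r.2) x < m → |x - e.1 r.1 r.2| < ε := fun r =>
    exists_forall_rateEnergy_lt (he r.1 r.2) (N.continuousOn_gain r.1 r.2) (N.gain_pos r.1 r.2) hε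
  choose m hm hmε using h1
  have hsmall : ∀ᶠ v : ℝ in 𝓝[>] 0, (0 < v ∧ ∀ r, v < m r) ∧ ∀ l, 2 * N.γ l * v < ε ^ 2 := by
    refine ((eventually_mem_nhdsWithin (a := (0 : ℝ)) (s := Set.Ioi 0)).and (eventually_all.2
      fun r => nhdsWithin_le_nhds (eventually_lt_nhds (hm r)))).and (eventually_all.2 fun l => ?_)
    have hc : Tendsto (fun v : ℝ => 2 * N.γ l * v) (𝓝 0) (𝓝 (2 * N.γ l * 0)) :=
      (by fun_prop : Continuous fun v : ℝ => 2 * N.γ l * v).tendsto 0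
    rw [mul_zero] at hc
    exact (hc.mono_left nhdsWithin_le_nhds).eventually_lt_const (by positivity)
  obtain ⟨v, ⟨hv0, hvm⟩, hvl⟩ := hsmall.exists
  refine ⟨v, hv0, fun z hz hzv => ?_⟩
  rw [Prod.dist_eq, max_lt_iff, dist_pi_lt_iff hε, dist_pi_lt_iff hε]
  refine ⟨fun s => (dist_pi_lt_iff hε).2 fun r => ?_, fun l => ?_⟩
  · rw [Real.dist_eq]
    exact hmε ⟨s, r⟩ _ (hz s r) ((rateEnergy_le_energy he hz s r).trans_lt (hzv.trans (hvm _)))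
  · rw [Real.dist_eq]
    refine abs_lt_of_sq_lt_sq ?_ hε.le
    have hγ : 0 < 2 * N.γ l := mul_pos two_pos (N.γ_pos l)
    exact ((sq_sub_le_energy he hz l).trans (by gcongr)).trans_lt (hvl l)

theorem continuousAt_energy (he : ∀ s r, 0 < e.1 s r) : ContinuousAt (N.energy e) e := by
  refine ContinuousAt.add (tendsto_finsetSum _ fun r _ => ?_) (tendsto_finsetSum _ fun l _ => ?_)
  · have h1 := (hasDerivAt_rateEnergy (he r.1 r.2) (N.continuousOn_gain r.1 r.2)
      (N.gain_pos r.1 r.2) (he r.1 r.2)).continuousAt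
    have h2 : Continuous fun z : (∀ s, ρ s → ℝ) × (L → ℝ) => z.1 r.1 r.2 := by fun_prop
    exact h1.tendsto.comp (h2.tendsto e)
  · exact (by fun_prop : Continuous fun z : (∀ s, ρ s → ℝ) × (L → ℝ) =>
      (z.2 l - e.2 l) ^ 2 / (2 * N.γ l)).tendsto e

theorem energy_self : N.energy e e = 0 := by simp [energy]

theorem IsEquilibrium.energy_le (h2 : N.C2) (h3 : N.C3) (hk : N.GainOfOwnRate)
    (he : N.IsEquilibrium e) {T : EReal}
    {z : ℝ → (∀ s, ρ s → ℝ) × (L → ℝ)} (hz : N.IsTrajectory T z) {a b : ℝ} (ha : 0 ≤ a)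
    (hpos : ∀ s r, 0 < (z a).1 s r) (hab : a ≤ b) (hbT : (b : EReal) < T) :
    N.energy e (z b) ≤ N.energy e (z a) := by
  have h := he.energy_sub_le h2 h3 hk hz (w := 0) ha hpos hab hbT fun t ht =>
    h2.dissipation_nonneg (he.rate_pos h3) fun s r => hz.rate_pos h2 h3 (ha.trans_lt ht.1)
      ((EReal.coe_le_coe_iff.2 ht.2.le).trans_lt hbT) s r
  linarith

theorem IsEquilibrium.lyapunovStable (h2 : N.C2) (h3 : N.C3) (hk : N.GainOfOwnRate)
    (he : N.IsEquilibrium e) : N.LyapunovStable e := by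
  intro ε hε
  have hrate := he.rate_pos h3
  obtain ⟨m, hm, hmε⟩ := exists_forall_energy_lt (N := N) hrate hε
  have hE : ∀ᶠ z in 𝓝 e, N.energy e z < m :=
    (continuousAt_energy (N := N) hrate).eventually_lt_const (by rwa [energy_self])
  have hP : ∀ᶠ z in 𝓝 e, ∀ r : Σ s, ρ s, 0 < z.1 r.1 r.2 := eventually_all.2 fun r => by
    have h : Continuous fun z : (∀ s, ρ s → ℝ) × (L → ℝ) => z.1 r.1 r.2 := by fun_prop
    exact (h.tendsto e).eventually_const_lt (hrate r.1 r.2)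
  obtain ⟨δ, hδ, hδ'⟩ := Metric.eventually_nhds_iff.1 (hE.and hP)
  refine ⟨δ, hδ, fun T z hz hz0 t ht htT => ?_⟩
  obtain ⟨hE0, hP0⟩ := hδ' hz0
  have hpos : ∀ s r, 0 < (z t).1 s r := by
    intro s r
    rcases ht.eq_or_lt with h | h
    · rw [← h]; exact hP0 ⟨s, r⟩
    · exact hz.rate_pos h2 h3 h htT s r
  exact hmε _ hpos ((he.energy_le h2 h3 hk hz le_rfl (fun s r => hP0 ⟨s, r⟩) ht htT).trans_lt hE0)

/-! ### Boundedness of trajectories -/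

theorem exists_price_dist_le (he : ∀ s r, 0 < e.1 s r) (C : ℝ) :
    ∃ P, ∀ z : (∀ s, ρ s → ℝ) × (L → ℝ), (∀ s r, 0 < z.1 s r) → N.energy e z ≤ C →
      dist z.2 e.2 ≤ P := by
  obtain ⟨P, hP0, hP⟩ : ∃ P : ℝ, 0 ≤ P ∧ ∀ l, 2 * N.γ l * C ≤ P ^ 2 :=
    ((eventually_ge_atTop 0).and (eventually_all.2 fun l =>
      (tendsto_pow_atTop two_ne_zero).eventually_ge_atTop _)).exists
  refine ⟨P, fun z hz hzC => (dist_pi_le_iff hP0).2 fun l => ?_⟩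
  rw [Real.dist_eq]
  have hγ : 0 < 2 * N.γ l := mul_pos two_pos (N.γ_pos l)
  exact abs_le_of_sq_le_sq ((sq_sub_le_energy he hz l).trans (le_trans (by gcongr) (hP l))) hP0

theorem IsEquilibrium.trajectoriesBounded (h2 : N.C2) (h3 : N.C3) (hk : N.GainOfOwnRate)
    (he : N.IsEquilibrium e) (hdiv : N.GainIntegralDiverges) : N.TrajectoriesBounded := by
  intro T z hz
  by_cases hT : (0 : EReal) < T
  swap
  · exact ⟨0, fun t ht htT => absurd ((EReal.coe_le_coe_iff.2 ht).trans_lt htT) hT⟩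
  have hrate := he.rate_pos h3
  obtain ⟨t₁, ht₁, ht₁T⟩ := EReal.lt_iff_exists_real_btwn.1 hT
  have ht₁0 : 0 < t₁ := EReal.coe_lt_coe_iff.1 ht₁
  obtain ⟨B₁, hB₁⟩ := isCompact_Icc.exists_bound_of_continuousOn
    (hz.continuousOn ht₁0.le ht₁T)
  set C := N.energy e (z t₁) with hC
  obtain ⟨P, hP⟩ := exists_price_dist_le (N := N) hrate C
  have hdiv' : ∀ r : Σ s, ρ s,
      Tendsto (fun b : ℝ => ∫ u in (1 : ℝ)..b, u / N.gain r.1 r.2 u) atTop atTop :=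
    fun r => hdiv r.1 r.2
  obtain ⟨B₂, hB₂0, hB₂⟩ : ∃ B : ℝ, 0 ≤ B ∧ ∀ r : Σ s, ρ s, ∀ x, B ≤ x →
      C < rateEnergy (N.gain r.1 r.2) (e.1 r.1 r.2) x :=
    ((eventually_ge_atTop 0).and (eventually_all.2 fun r =>
      eventually_forall_ge_atTop.2 ((tendsto_rateEnergy_atTop (hrate r.1 r.2)
        (N.continuousOn_gain r.1 r.2) (N.gain_pos r.1 r.2)
        (hdiv' r)).eventually_gt_atTop C))).exists
  refine ⟨max B₁ (max B₂ (P + ‖e.2‖)), fun t ht htT => ?_⟩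
  rcases le_total t t₁ with h | h
  · exact (hB₁ t ⟨ht, h⟩).trans (le_max_left _ _)
  · have hpos₁ : ∀ s r, 0 < (z t₁).1 s r := hz.rate_pos h2 h3 ht₁0 ht₁T
    have hpos : ∀ s r, 0 < (z t).1 s r := hz.rate_pos h2 h3 (ht₁0.trans_le h) htT
    have hE := he.energy_le h2 h3 hk hz ht₁0.le hpos₁ h htT
    refine le_trans ?_ (le_max_right _ _)
    rw [Prod.norm_def]
    refine max_le_max ((pi_norm_le_iff_of_nonneg hB₂0).2 fun s =>
      (pi_norm_le_iff_of_nonneg hB₂0).2 fun r => ?_) ?_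
    · rw [Real.norm_of_nonneg (hpos s r).le]
      by_contra! hlt
      exact (hB₂ ⟨s, r⟩ _ hlt.le).not_ge ((rateEnergy_le_energy hrate hpos s r).trans hE)
    · have h1 := hP _ hpos hE
      rw [dist_eq_norm] at h1
      have h4 := norm_add_le ((z t).2 - e.2) e.2
      rw [sub_add_cancel] at h4
      linarith

/-! ### Convergence to the equilibrium -/

omit [Fintype L] [Fintype S] in
theorem continuousAt_k {x : ∀ s, ρ s → ℝ} {s : S} (hx : ∀ r, 0 < x s r) (r : ρ s) :
    ContinuousAt (fun x : ∀ s, ρ s → ℝ => N.k s r (x s)) x := by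
  exact ((N.k_continuousOn s r).continuousAt (isOpen_forall_pos.mem_nhds hx)).comp
    (continuous_apply s).continuousAt

theorem C2.exists_speed_bound (h2 : N.C2) {η : ℝ}
    (hη : ∀ x ∈ Metric.closedBall e.1 η, ∀ s r, 0 < x s r) (P : ℝ) :
    ∃ V > 0, ∀ x ∈ Metric.closedBall e.1 η, ∀ p ∈ Metric.closedBall e.2 P, ∀ s r,
      |N.k s r (x s) * (N.Φ s (x s) r - N.q p s r)| ≤ V := by
  have h : ∀ r : Σ s, ρ s, ∃ C, ∀ z ∈ Metric.closedBall e.1 η ×ˢ Metric.closedBall e.2 P,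
      ‖N.k r.1 r.2 (z.1 r.1) * (N.Φ r.1 (z.1 r.1) r.2 - N.q z.2 r.1 r.2)‖ ≤ C := by
    intro r
    refine ((isCompact_closedBall e.1 η).prod
      (isCompact_closedBall e.2 P)).exists_bound_of_continuousOn fun z hz => ?_
    have hpos := hη z.1 hz.1 r.1
    have hf := continuous_fst.tendsto (x := z)
    exact (((continuousAt_k (N := N) hpos r.2).tendsto.comp hf).mul
      (((h2.continuousAt_Φ hpos r.2).tendsto.comp hf).sub
      (((N.continuous_q r.1 r.2).comp continuous_snd).tendsto z))).mono_left nhdsWithin_le_nhds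
  choose C hC using h
  obtain ⟨V, hV0, hV⟩ : ∃ V : ℝ, 0 < V ∧ ∀ r, C r ≤ V :=
    ((eventually_gt_atTop 0).and (eventually_all.2 fun r => eventually_ge_atTop (C r))).exists
  exact ⟨V, hV0, fun x hx p hp s r => (hC ⟨s, r⟩ (x, p) ⟨hx, hp⟩).trans (hV _)⟩

variable {z : ℝ → (∀ s, ρ s → ℝ) × (L → ℝ)}

theorem IsEquilibrium.exists_price_bound (h2 : N.C2) (h3 : N.C3) (hk : N.GainOfOwnRate)
    (he : N.IsEquilibrium e) (hz : N.IsTrajectory ⊤ z) :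
    ∃ P, ∀ t, 1 ≤ t → (z t).2 ∈ Metric.closedBall e.2 P := by
  have hpos : ∀ t, 0 < t → ∀ s r, 0 < (z t).1 s r := fun t ht =>
    hz.rate_pos h2 h3 ht (EReal.coe_lt_top t)
  obtain ⟨P, hP⟩ := exists_price_dist_le (N := N) (he.rate_pos h3) (N.energy e (z 1))
  exact ⟨P, fun t ht => hP _ (hpos t (by linarith))
    (he.energy_le h2 h3 hk hz zero_le_one (hpos 1 one_pos) ht (EReal.coe_lt_top t))⟩

/-- Rates converge although the energy need not bound them: each crossing of a shell around `e.1`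
costs a fixed amount of energy. -/
theorem IsEquilibrium.tendsto_rate (h2 : N.C2) (h3 : N.C3) (hk : N.GainOfOwnRate)
    (he : N.IsEquilibrium e) (hz : N.IsTrajectory ⊤ z) :
    Tendsto (fun t => (z t).1) atTop (𝓝 e.1) := by
  have hT : ∀ t : ℝ, (t : EReal) < ⊤ := EReal.coe_lt_top
  have hrate := he.rate_pos h3
  have hpos : ∀ t, 0 < t → ∀ s r, 0 < (z t).1 s r := fun t ht => hz.rate_pos h2 h3 ht (hT t)
  obtain ⟨P, hP⟩ := he.exists_price_bound h2 h3 hk hz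
  rw [Metric.tendsto_atTop]
  intro ε hε
  obtain ⟨η, hη, hηε, hball⟩ := exists_closedBall_rate_pos hrate hε
  obtain ⟨V, hV, hspeed⟩ := h2.exists_speed_bound hball P
  obtain ⟨w, hw, hdis⟩ := h2.exists_le_dissipation hrate (half_pos hη)
  -- Wherever the rates are at distance at least `η / 2`, energy is lost at a rate at least `w`.
  have hdrop : ∀ a b, 1 ≤ a → a ≤ b → (∀ t ∈ Set.Icc a b, η / 2 ≤ dist (z t).1 e.1) →
      N.energy e (z b) - N.energy e (z a) ≤ -w * (b - a) := by
    intro a b ha hab h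
    exact he.energy_sub_le h2 h3 hk hz (by linarith) (hpos a (by linarith)) hab (hT b)
      fun t ht => hdis _ (hpos t (by linarith [ht.1])) (h t (Set.Ioo_subset_Icc_self ht))
  have hanti : ∀ a b, 1 ≤ a → a ≤ b → N.energy e (z b) ≤ N.energy e (z a) := fun a b ha hab =>
    he.energy_le h2 h3 hk hz (by linarith) (hpos a (by linarith)) hab (hT b)
  -- From `t₀` on, too little energy is left for crossing the shell between `η / 2` and `η`.
  obtain ⟨t₀, ht₀, hlast⟩ : ∃ t₀, 1 ≤ t₀ ∧ ∀ t, t₀ ≤ t →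
      N.energy e (z t₀) - N.energy e (z t) < w * (η / 2 / V) := by
    set A := (fun t => N.energy e (z t)) '' Set.Ici 1
    have hA : BddBelow A := ⟨0, by
      rintro _ ⟨t, ht, rfl⟩
      exact energy_nonneg hrate (hpos t (one_pos.trans_le ht))⟩
    obtain ⟨_, ⟨t₀, ht₀, rfl⟩, hlt⟩ := Real.lt_sInf_add_pos (s := A) ⟨_, 1, Set.self_mem_Ici, rfl⟩
      (show 0 < w * (η / 2 / V) by positivity)
    refine ⟨t₀, ht₀, fun t ht => ?_⟩
    have := csInf_le hA ⟨t, Set.mem_Ici.2 (le_trans ht₀ ht), rfl⟩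
    linarith
  obtain ⟨t₁, ht₁, hclose⟩ : ∃ t₁, t₀ ≤ t₁ ∧ dist (z t₁).1 e.1 < η / 2 := by
    by_contra! hfar
    have hle : t₀ ≤ t₀ + η / 2 / V := le_add_of_nonneg_right (by positivity)
    have h1 := hdrop t₀ _ ht₀ hle fun t ht => hfar t ht.1
    have h2 := hlast _ hle
    rw [add_sub_cancel_left] at h1
    linarith
  refine ⟨t₁, fun t ht => lt_of_lt_of_le ?_ hηε⟩
  by_contra! hfar
  have hcont : ContinuousOn (fun t => dist (z t).1 e.1) (Set.Icc t₁ t) := by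
    have h := (hz.continuousOn (by linarith : 0 ≤ t) (hT t)).mono
      (Set.Icc_subset_Icc_left (by linarith : 0 ≤ t₁))
    exact (by fun_prop : Continuous fun y : ∀ s, ρ s → ℝ => dist y e.1).comp_continuousOn
      (continuous_fst.comp_continuousOn h)
  obtain ⟨a, b, hta, hab, hbt, hda, hdb, hshell⟩ :=
    exists_crossing ht hcont (by linarith : η / 2 < η) hclose.le hfar
  have h1a : 1 ≤ a := by linarith
  have hd := hdrop a b h1a hab.le fun u hu => (hshell u hu).1
  have ht0a := hanti t₀ a ht₀ (ht₁.trans hta)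
  have hl := hlast b (by linarith)
  have htime : b - a < η / 2 / V := by
    refine lt_of_mul_lt_mul_left ?_ hw.le
    linarith
  -- A crossing that fast would exceed the bound `V` on the speed.
  have hmove : dist (z b).1 (z a).1 ≤ V * (b - a) := by
    have hVab : 0 ≤ V * (b - a) := mul_nonneg hV.le (by linarith)
    refine (dist_pi_le_iff hVab).2 fun s => (dist_pi_le_iff hVab).2 fun r => ?_
    refine abs_sub_le_mul_sub_of_ae_hasDerivAt hab.le
      (hz.rate_ac_of_le (by linarith : 0 ≤ a) hab.le (hT b) s r) ?_
    filter_upwards [hz.rate_eq] with u hu hau hub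
    have h := hu (by linarith) (hT u)
    refine ⟨_, ?_, (h s r).2⟩
    rw [proj_of_pos (h s r).1]
    exact hspeed _ (hshell u ⟨hau.le, hub.le⟩).2 _ (hP u (by linarith)) s r
  have htri := dist_triangle (z b).1 (z a).1 e.1
  have hVt : V * (b - a) < η / 2 := by
    rw [lt_div_iff₀ hV] at htime
    linarith
  linarith

theorem IsTrajectory.exists_price_lipschitz (hz : N.IsTrajectory ⊤ z) {x₀ : ∀ s, ρ s → ℝ} {t₀ : ℝ}
    (ht₀ : 0 ≤ t₀) (hx : ∀ t, t₀ ≤ t → (z t).1 ∈ Metric.closedBall x₀ 1) (l : L) :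
    ∃ Λ, ∀ a b, t₀ ≤ a → a ≤ b → |(z b).2 l - (z a).2 l| ≤ Λ * (b - a) := by
  obtain ⟨C, hC⟩ := (isCompact_closedBall x₀ 1).exists_bound_of_continuousOn
    (f := fun x => N.y x l - N.c l) ((N.continuous_y l).sub continuous_const).continuousOn
  refine ⟨N.γ l * C, fun a b ha hab => ?_⟩
  refine abs_sub_le_mul_sub_of_ae_hasDerivAt hab
    (hz.price_ac_of_le (ht₀.trans ha) hab (EReal.coe_lt_top b) l) ?_
  filter_upwards [hz.price_eq] with u hu hau hub
  refine ⟨_, ?_, hu (by linarith) (EReal.coe_lt_top u) l⟩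
  rw [abs_mul, abs_of_pos (N.γ_pos l)]
  exact mul_le_mul_of_nonneg_left ((abs_proj_le _ _).trans (hC _ (hx u (by linarith))))
    (N.γ_pos l).le

theorem IsEquilibrium.tendsto_q (h2 : N.C2) (h3 : N.C3) (hk : N.GainOfOwnRate)
    (he : N.IsEquilibrium e) (hz : N.IsTrajectory ⊤ z) (s : S) (r : ρ s) :
    Tendsto (fun t => N.q (z t).2 s r) atTop (𝓝 (N.q e.2 s r)) := by
  have hT : ∀ t : ℝ, (t : EReal) < ⊤ := EReal.coe_lt_top
  have hrate := he.rate_pos h3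
  have hx := he.tendsto_rate h2 h3 hk hz
  have hkpos := N.k_pos s r _ (hrate s)
  have hkev : ∀ᶠ t in atTop, N.k s r (e.1 s) / 2 < N.k s r ((z t).1 s) :=
    ((continuousAt_k (N := N) (hrate s) r).tendsto.comp hx).eventually_const_lt (half_lt_self hkpos)
  have hφ : Tendsto (fun t => N.Φ s ((z t).1 s) r) atTop (𝓝 (N.q e.2 s r)) := by
    rw [← he.Φ_eq h3]
    exact (h2.continuousAt_Φ (hrate s) r).tendsto.comp hx
  obtain ⟨t₀, ht₀⟩ := eventually_atTop.1 ((eventually_ge_atTop 0).and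
    (hkev.and (hx.eventually (Metric.closedBall_mem_nhds e.1 one_pos))))
  have ht₀0 := (ht₀ t₀ le_rfl).1
  have hlip := hz.exists_price_lipschitz ht₀0 fun t ht => (ht₀ t ht).2.2
  choose Λ hΛ using hlip
  refine tendsto_of_tendsto_of_hasDerivAt (half_pos hkpos)
    (tendsto_pi_nhds.1 (tendsto_pi_nhds.1 hx s) r)
    (fun a b ha hab => hz.rate_ac_of_le (ht₀0.trans ha) hab (hT b) s r) (k := fun t =>
      N.k s r ((z t).1 s)) ?_ (fun t ht => (ht₀ t ht).2.1.le) hφ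
    (Λ := ∑ l, |N.H l ⟨s, r⟩| * Λ l) fun a b ha hab => ?_
  · filter_upwards [hz.rate_eq] with t ht htt
    have h := ht (by linarith) (hT t) s r
    rw [proj_of_pos h.1] at h
    exact h.2
  · rw [← q_sub, Finset.sum_mul]
    refine (Finset.abs_sum_le_sum_abs _ _).trans (Finset.sum_le_sum fun l _ => ?_)
    rw [abs_mul, mul_assoc]
    exact mul_le_mul_of_nonneg_left (hΛ l a b ha hab) (abs_nonneg _)

theorem IsEquilibrium.globallyAttractive (h2 : N.C2) (h3 : N.C3) (hk : N.GainOfOwnRate)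
    (he : N.IsEquilibrium e) : N.GloballyAttractive e := by
  intro z hz
  obtain ⟨g, hg, hgq⟩ := N.exists_continuous_leftInverse_q h3.2
  have hq : Tendsto (fun t => N.q (z t).2) atTop (𝓝 (N.q e.2)) :=
    tendsto_pi_nhds.2 fun s => tendsto_pi_nhds.2 fun r => he.tendsto_q h2 h3 hk hz s r
  have hp : Tendsto (fun t => (z t).2) atTop (𝓝 e.2) := by
    have h := (hg.tendsto (N.q e.2)).comp hq
    simpa only [Function.comp_def, hgq] using h
  exact (he.tendsto_rate h2 h3 hk hz).prodMk_nhds hp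

end Network

end MPTCP

end

theorem theorem3 {L S : Type*} {ρ : S → Type*} [Fintype L] [Fintype S] [∀ s, Fintype (ρ s)]
    (N : MPTCP.Network L S ρ) (h1 : N.C1) (h2 : N.C2) (h3 : N.C3) (hk : N.GainOfOwnRate) :
    ∃ e : (∀ s, ρ s → ℝ) × (L → ℝ),
      N.IsEquilibrium e ∧ (∀ e', N.IsEquilibrium e' → e' = e) ∧
      N.GloballyAsymptoticallyStable e ∧
      (N.GainIntegralDiverges → N.TrajectoriesBounded) := by
  obtain ⟨e, he⟩ := MPTCP.Network.exists_isEquilibrium h2 h3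
  exact ⟨e, he, fun e' he' => he.eq h2 h3 he',
    ⟨he.lyapunovStable h2 h3 hk, he.globallyAttractive h2 h3 hk⟩, he.trajectoriesBounded h2 h3 hk⟩
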